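/- Let $n\ge 2$. Let $\mathcal S_0(\mathbb R^n)$ be the closed subspace of $\mathcal S(\mathbb R^n)$ of the functions $\phi$ with $\int_{\mathbb R^n} x^m\phi(x)\,dx=0$ for all $m\in\mathbb N_0^n$. Let $\mathcal S_0(\mathbb S^{n-1}\times\mathbb R)$ be the space of smooth functions $\varrho:\mathbb S^{n-1}\times\mathbb R\to\mathbb C$ all of whose derivatives (in both variables) decay faster than every power of $|p|$ as $|p|\to\infty$, uniformly in $u\in\mathbb S^{n-1}$, and for which $\int_{\mathbb R}p^k\varrho(u,p)\,dp=0$ for all $u\in\mathbb S^{n-1}$, $k\in\mathbb N_0$; its topology is given by the seminorms $\sup_{u,p}|p|^k\|D^l\varrho(u,p)\|$, $k,l\in\mathbb N_0$, where the derivatives are those at $(u,p)$ of the extension $(x,p)\mapsto\varrho(x/|x|,p)$ to $(\mathbb R^n\setminus\{0\})\times\mathbb R$. Let $\mathcal S_0'(\mathbb R^n)$ and $\mathcal S_0'(\mathbb S^{n-1}\times\mathbb R)$ be the dual spaces, with the strong dual topologies. For $\varrho\in\mathcal S_0(\mathbb S^{n-1}\times\mathbb R)$ let $$R^*\varrho(x)=\int_{\mathbb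 S^{n-1}}\varrho(u,x\cdot u)\,du,\qquad x\in\mathbb R^n,$$ where $du$ is the surface measure of $\mathbb S^{n-1}$. Then $R^*\varrho\in\mathcal S_0(\mathbb R^n)$, and for every $f\in\mathcal S_0'(\mathbb R^n)$ the formula $\langle Rf,\varrho\rangle=\langle f,R^*\varrho\rangle$ defines an element $Rf$ of $\mathcal S_0'(\mathbb S^{n-1}\times\mathbb R)$. The resulting linear map, the distributional Radon transform $$R:\mathcal S_0'(\mathbb R^n)\to R(\mathcal S_0'(\mathbb R^n))\subset\mathcal S_0'(\mathbb S^{n-1}\times\mathbb R),$$ is an isomorphism of topological vector spaces onto its range, the range carrying the topology induced by $\mathcal S_0'(\mathbb S^{n-1}\times\mathbb R)$. -/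

import Mathlib

open MeasureTheory
open scoped ContDiff SchwartzMap

noncomputable section

namespace LizorkinRadon

/-- Euclidean space `ℝⁿ`. -/
abbrev E (n : ℕ) : Type := EuclideanSpace ℝ (Fin n)

/-- The unit sphere `𝕊ⁿ⁻¹` of `ℝⁿ`. -/
abbrev S (n : ℕ) : Type := Metric.sphere (0 : E n) 1

/-! ### Lizorkin functions on `ℝⁿ` -/

theorem integrable_monomial_mul {n : ℕ} (m : Fin n → ℕ) (φ : 𝓢(E n, ℂ)) :
    Integrable (fun x : E n => (((∏ i, x i ^ m i : ℝ)) : ℂ) * φ x) := by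
  refine (φ.integrable_pow_mul volume (∑ i, m i)).mono' ?_ ?_
  · refine (Continuous.mul ?_ φ.continuous).aestronglyMeasurable
    exact Complex.continuous_ofReal.comp (by fun_prop)
  · refine Filter.Eventually.of_forall fun x => ?_
    rw [norm_mul, Complex.norm_real, norm_prod, ← Finset.prod_pow_eq_pow_sum]
    gcongr with i _
    rw [norm_pow]
    gcongr
    exact PiLp.norm_apply_le x i

/-- `𝒮₀(ℝⁿ)`: the Schwartz functions all of whose moments vanish, as a subspace of `𝒮(ℝⁿ)`.
As a type it carries the subspace topology. -/
def lizorkin (n : ℕ) : Submodule ℂ 𝓢(E n, ℂ) where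
  carrier := {φ | ∀ m : Fin n → ℕ, ∫ x : E n, (((∏ i, x i ^ m i : ℝ)) : ℂ) * φ x = 0}
  zero_mem' := by intro m; simp
  add_mem' := by
    intro φ ψ hφ hψ m
    simp only [add_apply, mul_add]
    rw [integral_add (integrable_monomial_mul m φ) (integrable_monomial_mul m ψ), hφ m, hψ m,
      add_zero]
  smul_mem' := by
    intro c φ hφ m
    simp only [smul_apply, smul_eq_mul, mul_left_comm _ c]
    rw [integral_const_mul, hφ m, mul_zero]

/-! ### Schwartz and Lizorkin functions on `𝕊ⁿ⁻¹ × ℝ` -/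

/-- The extension of a function on `𝕊ⁿ⁻¹ × ℝ` to `(ℝⁿ ∖ {0}) × ℝ` that is homogeneous of
degree `0` in the first variable: `(x, p) ↦ ρ (x / |x|, p)` (and `0` at `x = 0`). -/
def homExt {n : ℕ} (ρ : S n → ℝ → ℂ) (z : E n × ℝ) : ℂ :=
  open Classical in
  if h : z.1 ≠ 0 then
    ρ ⟨‖z.1‖⁻¹ • z.1, by simp [norm_smul, inv_mul_cancel₀ (norm_ne_zero_iff.mpr h)]⟩ z.2
  else 0

theorem homExt_sphere {n : ℕ} (ρ : S n → ℝ → ℂ) (u : S n) (p : ℝ) :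
    homExt ρ ((u : E n), p) = ρ u p := by
  have h1 : ‖(u : E n)‖ = 1 := by simp
  have h0 : (u : E n) ≠ 0 := by rw [← norm_ne_zero_iff, h1]; exact one_ne_zero
  simp [homExt, h0]

theorem homExt_zero {n : ℕ} : homExt (0 : S n → ℝ → ℂ) = 0 := by
  funext z; simp [homExt]

theorem homExt_add {n : ℕ} (ρ σ : S n → ℝ → ℂ) : homExt (ρ + σ) = homExt ρ + homExt σ := by
  funext z; by_cases h : z.1 = 0 <;> simp [homExt, h]

theorem homExt_smul {n : ℕ} (c : ℂ) (ρ : S n → ℝ → ℂ) : homExt (c • ρ) = c • homExt ρ := by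
  funext z; by_cases h : z.1 = 0 <;> simp [homExt, h]

/-- `ρ` is a smooth function on the manifold `𝕊ⁿ⁻¹ × ℝ`, expressed by the smoothness of its
homogeneous extension on `(ℝⁿ ∖ {0}) × ℝ`. -/
def IsSmooth {n : ℕ} (ρ : S n → ℝ → ℂ) : Prop :=
  ContDiffOn ℝ ∞ (homExt ρ) {z | z.1 ≠ 0}

theorem isOpen_fst_ne {n : ℕ} : IsOpen {z : E n × ℝ | z.1 ≠ 0} :=
  isOpen_ne_fun continuous_fst continuous_const

theorem IsSmooth.contDiffAt {n : ℕ} {ρ : S n → ℝ → ℂ} (h : IsSmooth ρ) (u : S n) (p : ℝ)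
    (l : ℕ) : ContDiffAt ℝ l (homExt ρ) ((u : E n), p) := by
  have h0 : (u : E n) ≠ 0 := by
    rw [← norm_ne_zero_iff]; simp
  exact (ContDiffOn.contDiffAt h (isOpen_fst_ne.mem_nhds h0)).of_le (by exact_mod_cast le_top)

/-- `𝒮(𝕊ⁿ⁻¹ × ℝ)` as a space of functions: `ρ` is smooth, and each of its derivatives (in both
variables, the derivatives along the sphere being those of the homogeneous extension) decays
faster than any power of `|p|`, uniformly on the sphere. -/
def sphereSchwartz (n : ℕ) : Submodule ℂ (S n → ℝ → ℂ) where
  carrier := {ρ | IsSmooth ρ ∧ ∀ k l : ℕ, ∃ C : ℝ, ∀ (u : S n) (p : ℝ),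
    |p| ^ k * ‖iteratedFDeriv ℝ l (homExt ρ) ((u : E n), p)‖ ≤ C}
  zero_mem' := by
    refine ⟨?_, fun k l => ⟨0, fun u p => ?_⟩⟩
    · rw [IsSmooth, homExt_zero]; exact contDiffOn_const
    · rw [homExt_zero, iteratedFDeriv_zero]; simp
  add_mem' := by
    rintro ρ σ ⟨hρ, hρ'⟩ ⟨hσ, hσ'⟩
    refine ⟨?_, fun k l => ?_⟩
    · rw [IsSmooth, homExt_add]; exact ContDiffOn.add hρ hσ
    · obtain ⟨C, hC⟩ := hρ' k l
      obtain ⟨D, hD⟩ := hσ' k l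
      refine ⟨C + D, fun u p => ?_⟩
      rw [homExt_add, iteratedFDeriv_add_apply (hρ.contDiffAt u p l) (hσ.contDiffAt u p l)]
      calc _ ≤ |p| ^ k * (‖iteratedFDeriv ℝ l (homExt ρ) ((u : E n), p)‖ +
              ‖iteratedFDeriv ℝ l (homExt σ) ((u : E n), p)‖) := by gcongr; exact norm_add_le _ _
        _ ≤ C + D := by rw [mul_add]; exact add_le_add (hC u p) (hD u p)
  smul_mem' := by
    rintro c ρ ⟨hρ, hρ'⟩
    refine ⟨?_, fun k l => ?_⟩
    · rw [IsSmooth, homExt_smul]; exact ContDiffOn.const_smul c hρ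
    · obtain ⟨C, hC⟩ := hρ' k l
      refine ⟨‖c‖ * C, fun u p => ?_⟩
      rw [homExt_smul, iteratedFDeriv_const_smul_apply (hρ.contDiffAt u p l), norm_smul,
        mul_left_comm]
      exact mul_le_mul_of_nonneg_left (hC u p) (norm_nonneg _)

/-- The space `𝒮(𝕊ⁿ⁻¹ × ℝ)`. A type of its own, so that it does not inherit the topology of
pointwise convergence from the function space. -/
def SphereSchwartz (n : ℕ) : Type := ↥(sphereSchwartz n)

namespace SphereSchwartz

variable {n : ℕ}

instance : AddCommGroup (SphereSchwartz n) := inferInstanceAs (AddCommGroup ↥(sphereSchwartz n))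

instance : Module ℂ (SphereSchwartz n) := inferInstanceAs (Module ℂ ↥(sphereSchwartz n))

/-- The underlying function `(u, p) ↦ ρ (u, p)`. -/
def fn (ρ : SphereSchwartz n) : S n → ℝ → ℂ := ρ.1

theorem fn_zero : fn (0 : SphereSchwartz n) = 0 := rfl

theorem fn_add (ρ σ : SphereSchwartz n) : fn (ρ + σ) = fn ρ + fn σ := rfl

theorem fn_smul (c : ℂ) (ρ : SphereSchwartz n) : fn (c • ρ) = c • fn ρ := rfl

theorem isSmooth (ρ : SphereSchwartz n) : IsSmooth (fn ρ) := ρ.2.1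

theorem decay (ρ : SphereSchwartz n) (k l : ℕ) : ∃ C : ℝ, ∀ (u : S n) (p : ℝ),
    |p| ^ k * ‖iteratedFDeriv ℝ l (homExt (fn ρ)) ((u : E n), p)‖ ≤ C := ρ.2.2 k l

theorem bddAbove (ρ : SphereSchwartz n) (k l : ℕ) : BddAbove (Set.range fun z : S n × ℝ =>
    |z.2| ^ k * ‖iteratedFDeriv ℝ l (homExt (fn ρ)) ((z.1 : E n), z.2)‖) := by
  obtain ⟨C, hC⟩ := ρ.decay k l
  exact ⟨C, by rintro _ ⟨z, rfl⟩; exact hC z.1 z.2⟩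

/-- The seminorm `sup_{u, p} |p|ᵏ ‖Dˡ ρ (u, p)‖`. -/
def seminorm (n k l : ℕ) : Seminorm ℂ (SphereSchwartz n) :=
  Seminorm.ofSMulLE
    (fun ρ => ⨆ z : S n × ℝ,
      |z.2| ^ k * ‖iteratedFDeriv ℝ l (homExt (fn ρ)) ((z.1 : E n), z.2)‖)
    (by rw [fn_zero, homExt_zero, iteratedFDeriv_zero]; simp)
    (by
      intro ρ σ
      refine Real.iSup_le (fun z => ?_) (add_nonneg (Real.iSup_nonneg fun _ => by positivity)
        (Real.iSup_nonneg fun _ => by positivity))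
      rw [fn_add, homExt_add, iteratedFDeriv_add_apply (ρ.isSmooth.contDiffAt z.1 z.2 l)
        (σ.isSmooth.contDiffAt z.1 z.2 l)]
      calc _ ≤ |z.2| ^ k * (‖iteratedFDeriv ℝ l (homExt (fn ρ)) ((z.1 : E n), z.2)‖ +
              ‖iteratedFDeriv ℝ l (homExt (fn σ)) ((z.1 : E n), z.2)‖) := by
              gcongr; exact norm_add_le _ _
        _ ≤ _ := by
              rw [mul_add]
              exact add_le_add (le_ciSup (ρ.bddAbove k l) z) (le_ciSup (σ.bddAbove k l) z))
    (by
      intro c ρ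
      refine Real.iSup_le (fun z => ?_) (mul_nonneg (norm_nonneg _)
        (Real.iSup_nonneg fun _ => by positivity))
      rw [fn_smul, homExt_smul, iteratedFDeriv_const_smul_apply (ρ.isSmooth.contDiffAt z.1 z.2 l),
        norm_smul, mul_left_comm]
      exact mul_le_mul_of_nonneg_left (le_ciSup (ρ.bddAbove k l) z) (norm_nonneg _))

/-- The family of seminorms that defines the topology of `𝒮(𝕊ⁿ⁻¹ × ℝ)`. -/
def seminormFamily (n : ℕ) : SeminormFamily ℂ (SphereSchwartz n) (ℕ × ℕ) :=
  fun i => seminorm n i.1 i.2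

instance : TopologicalSpace (SphereSchwartz n) :=
  (seminormFamily n).moduleFilterBasis.topology'

theorem withSeminorms (n : ℕ) : WithSeminorms (seminormFamily n) := ⟨rfl⟩

instance : ContinuousSMul ℂ (SphereSchwartz n) :=
  (seminormFamily n).moduleFilterBasis.continuousSMul

instance : IsTopologicalAddGroup (SphereSchwartz n) :=
  (seminormFamily n).addGroupFilterBasis.isTopologicalAddGroup

theorem continuous_slice (ρ : SphereSchwartz n) (u : S n) : Continuous (fn ρ u) := by
  have h : fn ρ u = fun p => homExt (fn ρ) ((u : E n), p) := by
    funext p; rw [homExt_sphere]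
  rw [h, continuous_iff_continuousAt]
  intro p
  exact ContinuousAt.comp (f := fun p : ℝ => ((u : E n), p))
    (ρ.isSmooth.contDiffAt u p 0).continuousAt (by fun_prop)

theorem integrable_pow_mul (ρ : SphereSchwartz n) (u : S n) (k : ℕ) :
    Integrable (fun p : ℝ => (p : ℂ) ^ k * fn ρ u p) := by
  obtain ⟨C, hC⟩ := ρ.decay k 0
  obtain ⟨D, hD⟩ := ρ.decay (k + 2) 0
  refine (integrable_inv_one_add_sq.const_mul (C + D)).mono' ?_ ?_
  · exact (Continuous.mul (by fun_prop) (ρ.continuous_slice u)).aestronglyMeasurable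
  · refine Filter.Eventually.of_forall fun p => ?_
    have h1 := hC u p
    have h2 := hD u p
    rw [norm_iteratedFDeriv_zero, homExt_sphere] at h1 h2
    rw [norm_mul, norm_pow, Complex.norm_real, Real.norm_eq_abs, ← div_eq_mul_inv,
      le_div_iff₀ (by positivity)]
    have h3 : |p| ^ (k + 2) = |p| ^ k * p ^ 2 := by rw [pow_add, sq_abs]
    rw [h3] at h2
    nlinarith [Real.norm_eq_abs p]

end SphereSchwartz

/-- `𝒮₀(𝕊ⁿ⁻¹ × ℝ)`: the `ρ ∈ 𝒮(𝕊ⁿ⁻¹ × ℝ)` such that `ρ (u, ·)` has vanishing moments of all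
orders for every `u`. As a type it carries the subspace topology. -/
def sphereLizorkin (n : ℕ) : Submodule ℂ (SphereSchwartz n) where
  carrier := {ρ | ∀ (u : S n) (k : ℕ), ∫ p : ℝ, (p : ℂ) ^ k * ρ.fn u p = 0}
  zero_mem' := by intro u k; simp [SphereSchwartz.fn_zero]
  add_mem' := by
    intro ρ σ hρ hσ u k
    simp only [SphereSchwartz.fn_add, Pi.add_apply, mul_add]
    rw [integral_add (ρ.integrable_pow_mul u k) (σ.integrable_pow_mul u k), hρ u k, hσ u k,
      add_zero]
  smul_mem' := by
    intro c ρ hρ u k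
    simp only [SphereSchwartz.fn_smul, Pi.smul_apply, smul_eq_mul, mul_left_comm _ c]
    rw [integral_const_mul, hρ u k, mul_zero]

/-! ### Distributions and the Radon transform -/

/-- `𝒮₀'(ℝⁿ)` with the strong dual topology (uniform convergence on bounded sets). -/
abbrev LizorkinDistribution (n : ℕ) : Type := StrongDual ℂ (lizorkin n)

/-- `𝒮₀'(𝕊ⁿ⁻¹ × ℝ)` with the strong dual topology (uniform convergence on bounded sets). -/
abbrev SphereLizorkinDistribution (n : ℕ) : Type := StrongDual ℂ (sphereLizorkin n)

/-- The dual Radon transform `R*ρ (x) = ∫_{𝕊ⁿ⁻¹} ρ (u, x · u) du`, with respect to the surface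
measure of the sphere. -/
def backProjection {n : ℕ} (ρ : S n → ℝ → ℂ) (x : E n) : ℂ :=
  ∫ u : S n, ρ u (inner ℝ x (u : E n)) ∂((volume : Measure (E n)).toSphere)

/-- `g` is the Radon transform of the distribution `f`: `R*ρ ∈ 𝒮₀(ℝⁿ)` for every
`ρ ∈ 𝒮₀(𝕊ⁿ⁻¹ × ℝ)`, and `⟨g, ρ⟩ = ⟨f, R*ρ⟩`. -/
def IsRadonTransform {n : ℕ} (f : LizorkinDistribution n) (g : SphereLizorkinDistribution n) :
    Prop :=
  ∀ ρ : sphereLizorkin n, ∃ φ : lizorkin n,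
    (∀ x : E n, (φ : 𝓢(E n, ℂ)) x = backProjection (ρ : SphereSchwartz n).fn x) ∧ g ρ = f φ

end LizorkinRadon

end

noncomputable section

namespace LizorkinRadon

/-! ### Continuity from bounds -/

/-! The distributional transform $R$ is the transpose of $R^*$. If $R^*:\mathcal S_0(\mathbb
S^{n-1}\times\mathbb R)\to\mathcal S_0(\mathbb R^n)$ is continuous and has a continuous linear right
inverse $S$, then transposing $R^*S=\mathrm{id}$ gives a continuous left inverse of $R$ for the
strong topologies, so $R$ is an isomorphism onto its range.

Continuity of $R^*$. A function $\varrho$ is lifted to the Schwartz function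
$g(y,p)=\chi(|y|^2)\varrho(y/|y|,p/|y|)$ on $\mathbb R^n\times\mathbb R$, supported over an annulus.
In polar coordinates $Ag(x)=\int g(y,x\cdot y)\,dy$ is a positive constant times $R^*\varrho(x)$
(`dualRadon_liftLizorkin`), so flat calculus in $y$ replaces calculus on the sphere. Derivatives of
$Ag$ are averages of $y_i\partial_pg$. For decay, the vanishing moments give a Schwartz primitive
$G$ of $g$ in $p$; integrating $\partial_{y_i}[G(y,x\cdot y)]$ to zero yields
$x_iAg=-A(\partial_{y_i}G)$ (`dualRadon_dualRadonMul`). The moments of $Ag$ vanish because this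
identity reduces them to $\int Ag$, and $Ag=\sum_i\partial_{x_i}A(y_i|y|^{-2}G)$ is a divergence
(`integral_dualRadon_eq_zero`).

Right inverse. Fourier inversion in polar coordinates says $\varphi=R^*\varrho$ with
$\varrho(u,p)=\int_0^\infty s^{n-1}e^{2\pi isp}\hat\varphi(su)\,ds$. The moments of $\varphi$
vanish, so $\hat\varphi$ is flat at $0$ (`flatAtZero_fourier`). Flatness makes $s^j\hat\varphi(su)$
harmless at $s=0$ for every integer $j$: integration by parts has no boundary term and gives decay
in $p$ (`smul_halfLine`), and the moments of $\varrho(u,\cdot)$ vanish by Fourier inversion on the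
line (`integral_halfLine`). -/

theorem continuous_of_seminorm_bounds {𝕜 X Z ι : Type*} [NormedField 𝕜] [AddCommGroup X]
    [Module 𝕜 X] [TopologicalSpace X] [IsTopologicalAddGroup X] [AddCommGroup Z] [Module 𝕜 Z]
    [TopologicalSpace Z] [IsTopologicalAddGroup Z] {p : SeminormFamily 𝕜 Z ι}
    (hp : WithSeminorms p) (f : X →ₗ[𝕜] Z)
    (h : ∀ i, ∃ q : X → ℝ, Continuous q ∧ q 0 = 0 ∧ ∀ x, p i (f x) ≤ q x) : Continuous f := by
  refine continuous_of_continuousAt_zero f ?_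
  rw [ContinuousAt, map_zero, hp.tendsto_nhds]
  intro i ε hε
  obtain ⟨q, hq, hq0, hb⟩ := h i
  have := (hq.tendsto 0).eventually (gt_mem_nhds (hq0.trans_lt hε))
  filter_upwards [this] with x hx
  rw [sub_zero]
  exact (hb x).trans_lt hx

/-- A continuous linear map into a space of Schwartz functions, from bounds on the derivatives. -/
def schwartzMkCLM {𝕜 X W G : Type*} [RCLike 𝕜] [AddCommGroup X]
    [Module 𝕜 X] [TopologicalSpace X] [IsTopologicalAddGroup X] [NormedAddCommGroup W]
    [NormedSpace ℝ W] [NormedAddCommGroup G] [NormedSpace ℝ G] [NormedSpace 𝕜 G]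
    [SMulCommClass ℝ 𝕜 G] (A : X →ₗ[𝕜] W → G) (hs : ∀ x, ContDiff ℝ ∞ (A x))
    (hb : ∀ k l : ℕ, ∃ q : X → ℝ, Continuous q ∧ q 0 = 0 ∧
      ∀ x w, ‖w‖ ^ k * ‖iteratedFDeriv ℝ l (A x) w‖ ≤ q x) : X →L[𝕜] 𝓢(W, G) :=
  let T : X →ₗ[𝕜] 𝓢(W, G) :=
    { toFun := fun x => ⟨A x, hs x, fun k l => by
        obtain ⟨q, -, -, h⟩ := hb k l; exact ⟨q x, h x⟩⟩
      map_add' := fun x y => by ext w; exact congrFun (map_add A x y) w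
      map_smul' := fun c x => by ext w; exact congrFun (map_smul A c x) w }
  { T with
    cont := by
      refine continuous_of_seminorm_bounds (schwartz_withSeminorms 𝕜 W G) T fun i => ?_
      obtain ⟨q, hq, hq0, h⟩ := hb i.1 i.2
      refine ⟨fun x => |q x|, by fun_prop, by simp [hq0], fun x => ?_⟩
      exact SchwartzMap.seminorm_le_bound 𝕜 i.1 i.2 _ (abs_nonneg _)
        fun w => (h x w).trans (le_abs_self _) }

theorem continuous_schwartz_seminorm {W G : Type*} [NormedAddCommGroup W]
    [NormedSpace ℝ W] [NormedAddCommGroup G] [NormedSpace ℝ G] (k l : ℕ) :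
    Continuous (fun g : 𝓢(W, G) => SchwartzMap.seminorm ℝ k l g) :=
  (schwartz_withSeminorms ℝ W G).continuous_seminorm (k, l)

/-- Estimates take the form of a continuous $q$ with $q(0)=0$ instead of explicit seminorms: this
form survives precomposition with continuous linear operators, which drives the later inductions.
The weight here is integrable along each fibre. -/
theorem exists_continuous_bound_mul_one_add_sq {V F : Type*} [NormedAddCommGroup V]
    [NormedSpace ℝ V] [NormedAddCommGroup F] [NormedSpace ℝ F] (k : ℕ) :
    ∃ q : 𝓢(V × ℝ, F) → ℝ, Continuous q ∧ q 0 = 0 ∧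
      ∀ g z, ‖z‖ ^ k * ‖g z‖ ≤ q g * (1 + z.2 ^ 2)⁻¹ := by
  refine ⟨fun g => SchwartzMap.seminorm ℝ k 0 g + SchwartzMap.seminorm ℝ (k + 2) 0 g,
    (continuous_schwartz_seminorm k 0).add (continuous_schwartz_seminorm (k + 2) 0),
    by simp, fun g z => ?_⟩
  rw [← div_eq_mul_inv, le_div_iff₀ (by positivity)]
  have h1 := SchwartzMap.norm_pow_mul_le_seminorm ℝ g k z
  have h2 := SchwartzMap.norm_pow_mul_le_seminorm ℝ g (k + 2) z
  have h3 : z.2 ^ 2 ≤ ‖z‖ ^ 2 := by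
    rw [← sq_abs]; gcongr; exact norm_snd_le z
  have h4 : ‖z‖ ^ k * ‖g z‖ * z.2 ^ 2 ≤ ‖z‖ ^ k * ‖g z‖ * ‖z‖ ^ 2 := by gcongr
  have h5 : ‖z‖ ^ k * ‖g z‖ * ‖z‖ ^ 2 = ‖z‖ ^ (k + 2) * ‖g z‖ := by ring
  nlinarith

/-! ### Integration along the second factor -/

section Fiber

variable {V F G : Type*} [NormedAddCommGroup V] [NormedSpace ℝ V] [NormedAddCommGroup F]
  [NormedSpace ℝ F] [NormedAddCommGroup G] [NormedSpace ℝ G]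

/-- Provides one dominating function for all base points in a unit ball when differentiating under
the fibre integral. -/
theorem inv_one_add_sq_le_of_abs_le {a b : ℝ} (h : |a - b| ≤ 1) :
    (1 + a ^ 2)⁻¹ ≤ 4 * (1 + b ^ 2)⁻¹ := by
  rw [← div_eq_mul_inv, inv_le_comm₀ (by positivity) (by positivity), inv_div, div_le_iff₀ (by norm_num)]
  rw [abs_le] at h
  nlinarith [sq_nonneg (a + (a - b)), sq_nonneg (a - b)]

theorem integrable_inv_one_add_add_sq (r : ℝ) : Integrable fun q : ℝ => (1 + (r + q) ^ 2)⁻¹ :=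
  integrable_inv_one_add_sq.comp_add_left r

theorem schwartz_exists_fiber_bound (g : 𝓢(V × ℝ, F)) :
    ∃ C : ℝ, ∀ z, ‖g z‖ ≤ C * (1 + z.2 ^ 2)⁻¹ := by
  obtain ⟨q, -, -, h⟩ := exists_continuous_bound_mul_one_add_sq (V := V) (F := F) 0
  exact ⟨q g, fun z => by simpa using h g z⟩

theorem integrable_fiber (g : 𝓢(V × ℝ, F)) (z : V × ℝ) :
    Integrable fun q : ℝ => g (z + (0, q)) := by
  obtain ⟨C, hC⟩ := schwartz_exists_fiber_bound g
  refine ((integrable_inv_one_add_add_sq z.2).const_mul C).mono'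
    (Continuous.aestronglyMeasurable (by fun_prop)) (.of_forall fun q => ?_)
  exact hC (z + (0, q))

/-- The integral of the translates of `g` along the second factor over the set `s`. -/
def fiberIntegral (s : Set ℝ) (g : 𝓢(V × ℝ, F)) (z : V × ℝ) : F := ∫ q in s, g (z + (0, q))

theorem hasFDerivAt_fiberIntegral (s : Set ℝ) (g : 𝓢(V × ℝ, F)) (z : V × ℝ) :
    HasFDerivAt (fiberIntegral s g)
      (fiberIntegral s (SchwartzMap.fderivCLM ℝ (V × ℝ) F g) z) z := by
  obtain ⟨C, hC⟩ := schwartz_exists_fiber_bound (SchwartzMap.fderivCLM ℝ (V × ℝ) F g)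
  have hC0 : 0 ≤ C := by
    have := (norm_nonneg _).trans (hC 0)
    simpa using this
  refine hasFDerivAt_integral_of_dominated_of_fderiv_le (s := Metric.ball z 1)
    (F := fun w q => g (w + (0, q)))
    (F' := fun w q => SchwartzMap.fderivCLM ℝ (V × ℝ) F g (w + (0, q)))
    (bound := fun q => C * (4 * (1 + (z.2 + q) ^ 2)⁻¹)) (Metric.ball_mem_nhds z one_pos)
    (.of_forall fun w => (Continuous.aestronglyMeasurable (by fun_prop)))
    (integrable_fiber g z).restrict (Continuous.aestronglyMeasurable (by fun_prop))
    (.of_forall fun q w hw => ?_)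
    (((integrable_inv_one_add_add_sq z.2).const_mul 4).const_mul C).restrict
    (.of_forall fun q w _ => ?_)
  · refine (hC _).trans ?_
    gcongr
    refine inv_one_add_sq_le_of_abs_le ?_
    have h1 : |w.2 - z.2| ≤ ‖w - z‖ := norm_snd_le (w - z)
    have h2 : ‖w - z‖ < 1 := by simpa [dist_eq_norm] using hw
    simp only [Prod.snd_add, add_sub_add_right_eq_sub]
    linarith
  · exact (hasFDerivAt_comp_add_right (f := g) (0, q)).2 (g.hasFDerivAt (w + (0, q)))

theorem fderiv_fiberIntegral (s : Set ℝ) (g : 𝓢(V × ℝ, F)) :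
    fderiv ℝ (fiberIntegral s g) = fiberIntegral s (SchwartzMap.fderivCLM ℝ (V × ℝ) F g) :=
  funext fun z => (hasFDerivAt_fiberIntegral s g z).fderiv

end Fiber

/-- The derivative is a fibre integral with operator values, so the induction runs over all target
spaces at once. Fixing the universe `Type` keeps `V × ℝ →L[ℝ] F` within their range. -/
theorem contDiff_fiberIntegral {V : Type} [NormedAddCommGroup V] [NormedSpace ℝ V] (s : Set ℝ)
    (m : ℕ) : ∀ {F : Type} [NormedAddCommGroup F] [NormedSpace ℝ F] (g : 𝓢(V × ℝ, F)),
    ContDiff ℝ m (fiberIntegral s g) := by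
  induction m with
  | zero =>
    intro F _ _ g
    exact contDiff_zero.2 (continuous_iff_continuousAt.2 fun z =>
      (hasFDerivAt_fiberIntegral s g z).continuousAt)
  | succ m ih =>
    intro F _ _ g
    push_cast
    rw [contDiff_succ_iff_fderiv]
    refine ⟨fun z => (hasFDerivAt_fiberIntegral s g z).differentiableAt, by simp, ?_⟩
    rw [fderiv_fiberIntegral]
    exact ih _

section FiberLizorkin

variable {V F G : Type} [NormedAddCommGroup V] [NormedSpace ℝ V] [NormedAddCommGroup F]
  [NormedSpace ℝ F] [NormedAddCommGroup G] [NormedSpace ℝ G]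

/-- Multiplication by the `k`-th power of the second variable. -/
def fiberPow (k : ℕ) : 𝓢(V × ℝ, F) →L[ℝ] 𝓢(V × ℝ, F) :=
  SchwartzMap.smulLeftCLM F fun z : V × ℝ => z.2 ^ k

theorem fiberPow_apply (k : ℕ) (g : 𝓢(V × ℝ, F)) (z : V × ℝ) :
    fiberPow k g z = z.2 ^ k • g z :=
  SchwartzMap.smulLeftCLM_apply_apply
    ((ContinuousLinearMap.snd ℝ V ℝ).hasTemperateGrowth.pow k) g z

theorem integrable_slice (g : 𝓢(V × ℝ, F)) (y : V) : Integrable fun p : ℝ => g (y, p) := by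
  simpa using integrable_fiber g (y, 0)

theorem integrable_pow_smul_slice (k : ℕ) (g : 𝓢(V × ℝ, F)) (y : V) :
    Integrable fun p : ℝ => p ^ k • g (y, p) := by
  simpa only [fiberPow_apply] using integrable_slice (fiberPow k g) y

theorem fiberIntegral_univ (g : 𝓢(V × ℝ, F)) (z : V × ℝ) :
    fiberIntegral Set.univ g z = ∫ p, g (z.1, p) := by
  rw [fiberIntegral, setIntegral_univ, ← integral_add_left_eq_self (fun p => g (z.1, p)) z.2]
  congr with q
  congr 1
  ext <;> simp

theorem fderiv_slice (g : 𝓢(V × ℝ, F)) (z : V × ℝ) (q : ℝ) :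
    HasDerivAt (fun q : ℝ => g (z + (0, q))) (fderiv ℝ g (z + (0, q)) (0, 1)) q := by
  have h : HasDerivAt (fun q : ℝ => z + ((0 : V), q)) (0, 1) q :=
    ((hasDerivAt_const q (0 : V)).prodMk (hasDerivAt_id q)).const_add z
  exact (g.hasFDerivAt (z + (0, q))).comp_hasDerivAt q h

theorem integrable_fderiv_slice (g : 𝓢(V × ℝ, F)) (z : V × ℝ) :
    Integrable fun q : ℝ => fderiv ℝ g (z + (0, q)) (0, 1) :=
  (integrable_fiber (SchwartzMap.fderivCLM ℝ (V × ℝ) F g) z).apply_continuousLinearMap (0, 1)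

theorem integral_fderiv_slice (g : 𝓢(V × ℝ, F)) (y : V) :
    ∫ p : ℝ, fderiv ℝ g (y, p) (0, 1) = 0 := by
  have := integral_eq_zero_of_hasDerivAt_of_integrable (fderiv_slice g (y, 0))
    (integrable_fderiv_slice g (y, 0)) (integrable_fiber g (y, 0))
  simpa using this

/-- The Schwartz functions on `V × ℝ` whose restrictions to the fibres `{y} × ℝ` have vanishing
moments of all orders. -/
def fiberLizorkin (V F : Type) [NormedAddCommGroup V] [NormedSpace ℝ V] [NormedAddCommGroup F]
    [NormedSpace ℝ F] : Submodule ℝ 𝓢(V × ℝ, F) where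
  carrier := {g | ∀ (y : V) (k : ℕ), ∫ p : ℝ, p ^ k • g (y, p) = 0}
  zero_mem' := by intro y k; simp
  add_mem' := by
    intro f g hf hg y k
    simp only [add_apply, smul_add]
    rw [integral_add (integrable_pow_smul_slice k f y) (integrable_pow_smul_slice k g y), hf y k,
      hg y k, add_zero]
  smul_mem' := by
    intro c f hf y k
    simp only [smul_apply, smul_comm _ c]
    rw [integral_smul, hf y k, smul_zero]

theorem mem_fiberLizorkin {g : 𝓢(V × ℝ, F)} :
    g ∈ fiberLizorkin V F ↔ ∀ (y : V) (k : ℕ), ∫ p : ℝ, p ^ k • g (y, p) = 0 := Iff.rfl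

theorem mem_fiberLizorkin_iff {g : 𝓢(V × ℝ, F)} :
    g ∈ fiberLizorkin V F ↔ ∀ k, fiberIntegral Set.univ (fiberPow k g) = 0 := by
  simp only [mem_fiberLizorkin, funext_iff, fiberIntegral_univ, fiberPow_apply, Pi.zero_apply,
    Prod.forall]
  exact ⟨fun h k y _ => h y k, fun h y k => h k y 0⟩

theorem mem_fiberLizorkin_of_apply_eq [CompleteSpace F] [CompleteSpace G] {g : 𝓢(V × ℝ, F)}
    (hg : g ∈ fiberLizorkin V F) {h : 𝓢(V × ℝ, G)} (L : V → F →L[ℝ] G)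
    (hL : ∀ z, h z = L z.1 (g z)) : h ∈ fiberLizorkin V G := by
  intro y k
  simp only [hL, ← map_smul]
  rw [(L y).integral_comp_comm (integrable_pow_smul_slice k g y), hg y k, map_zero]

theorem fderiv_fiberPow (k : ℕ) (g : 𝓢(V × ℝ, F)) (z : V × ℝ) :
    fderiv ℝ (fiberPow k g) z = z.2 ^ k • fderiv ℝ g z +
      ((k * z.2 ^ (k - 1)) • ContinuousLinearMap.snd ℝ V ℝ).smulRight (g z) := by
  have h1 : ⇑(fiberPow k g) = fun z : V × ℝ => z.2 ^ k • g z := funext (fiberPow_apply k g)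
  have h2 : HasFDerivAt (fun z : V × ℝ => z.2 ^ k)
      ((k * z.2 ^ (k - 1)) • ContinuousLinearMap.snd ℝ V ℝ) z :=
    (hasDerivAt_pow k z.2).comp_hasFDerivAt z (hasFDerivAt_snd)
  rw [h1]
  exact (h2.smul (g.hasFDerivAt z)).fderiv

/-- Differentiate the identity $\int p^kg\,dp=0$, viewed as a function on $V\times\mathbb R$. The
product rule adds $kp^{k-1}g$, whose fibre integral is again a vanishing moment. -/
theorem fderiv_mem_fiberLizorkin [CompleteSpace F] {g : 𝓢(V × ℝ, F)}
    (hg : g ∈ fiberLizorkin V F) :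
    SchwartzMap.fderivCLM ℝ (V × ℝ) F g ∈ fiberLizorkin V (V × ℝ →L[ℝ] F) := by
  intro y k
  have h0 : ∫ p : ℝ, fderiv ℝ (fiberPow k g) (y, p) = 0 := by
    have h1 := fiberIntegral_univ (SchwartzMap.fderivCLM ℝ (V × ℝ) F (fiberPow k g)) (y, 0)
    rw [← fderiv_fiberIntegral, mem_fiberLizorkin_iff.1 hg k] at h1
    simpa using h1.symm
  let T : F →L[ℝ] V × ℝ →L[ℝ] F :=
    ContinuousLinearMap.smulRightL ℝ (V × ℝ) F (ContinuousLinearMap.snd ℝ V ℝ)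
  have h2 : ∀ p : ℝ, fderiv ℝ (fiberPow k g) (y, p) =
      p ^ k • SchwartzMap.fderivCLM ℝ (V × ℝ) F g (y, p) +
        (k : ℝ) • T (p ^ (k - 1) • g (y, p)) := by
    intro p
    rw [fderiv_fiberPow, SchwartzMap.fderivCLM_apply]
    congr 1
    refine ContinuousLinearMap.ext fun v => ?_
    change ((k : ℝ) * p ^ (k - 1) * v.2) • g (y, p) = (k : ℝ) • v.2 • p ^ (k - 1) • g (y, p)
    rw [smul_smul, smul_smul]
    ring_nf
  simp only [h2] at h0
  rw [integral_add (integrable_pow_smul_slice k _ y)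
    ((T.integrable_comp (integrable_pow_smul_slice (k - 1) g y)).fun_smul _), integral_smul,
    T.integral_comp_comm (integrable_pow_smul_slice (k - 1) g y), hg, map_zero, smul_zero,
    add_zero] at h0
  exact h0

/-- The derivative of a function with vanishing fibre moments. -/
def fiberFDeriv (V F : Type) [NormedAddCommGroup V] [NormedSpace ℝ V] [NormedAddCommGroup F]
    [NormedSpace ℝ F] [CompleteSpace F] :
    fiberLizorkin V F →L[ℝ] fiberLizorkin V (V × ℝ →L[ℝ] F) :=
  ((SchwartzMap.fderivCLM ℝ (V × ℝ) F).comp (fiberLizorkin V F).subtypeL).codRestrict _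
    fun g => fderiv_mem_fiberLizorkin g.2

/-- Post-composition with a continuous linear map depending on the base point. -/
def fiberBilin [CompleteSpace F] [CompleteSpace G] {θ : V → F →L[ℝ] G}
    (hθ : Function.HasTemperateGrowth θ) : fiberLizorkin V F →L[ℝ] fiberLizorkin V G :=
  ((SchwartzMap.bilinLeftCLM (ContinuousLinearMap.id ℝ (F →L[ℝ] G)).flip
    (hθ.comp (ContinuousLinearMap.fst ℝ V ℝ).hasTemperateGrowth)).comp
      (fiberLizorkin V F).subtypeL).codRestrict _
    fun g => mem_fiberLizorkin_of_apply_eq g.2 θ fun z => by simp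

end FiberLizorkin

/-! ### The primitive along the fibres -/

section Primitive

variable {V : Type} [NormedAddCommGroup V] [NormedSpace ℝ V]

/-- The condition on `s` says that translation moves away from $p=0$, hence $\|z\|\le\|z+(0,r)\|$
and the polynomial weight can be taken inside the integral. -/
theorem exists_bound_fiberIntegral {F : Type} [NormedAddCommGroup F] [NormedSpace ℝ F] (k : ℕ) :
    ∃ q : 𝓢(V × ℝ, F) → ℝ, Continuous q ∧ q 0 = 0 ∧ ∀ g (s : Set ℝ) (z : V × ℝ),
      MeasurableSet s → (∀ r ∈ s, |z.2| ≤ |z.2 + r|) → ‖z‖ ^ k * ‖fiberIntegral s g z‖ ≤ q g := by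
  obtain ⟨q, hq, hq0, h⟩ := exists_continuous_bound_mul_one_add_sq (V := V) (F := F) k
  refine ⟨fun g => q g * Real.pi, by fun_prop, by simp [hq0], fun g s z hs hz => ?_⟩
  have hb : ∀ r ∈ s, ‖‖z‖ ^ k • g (z + (0, r))‖ ≤ q g * (1 + (z.2 + r) ^ 2)⁻¹ := by
    intro r hr
    rw [norm_smul, norm_pow, norm_norm]
    refine le_trans ?_ (h g (z + (0, r)))
    have : ‖z‖ ≤ ‖z + (0, r)‖ := by
      rw [Prod.norm_def, Prod.norm_def]
      refine max_le_max ?_ ?_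
      · simp
      · exact hz r hr
    gcongr
  have hq' : 0 ≤ q g := by
    have h0 : 0 ≤ q g * (1 + (0 : V × ℝ).2 ^ 2)⁻¹ := le_trans (by positivity) (h g 0)
    simpa using h0
  calc ‖z‖ ^ k * ‖fiberIntegral s g z‖ = ‖∫ r in s, ‖z‖ ^ k • g (z + (0, r))‖ := by
        rw [integral_smul, norm_smul, norm_pow, norm_norm, fiberIntegral]
    _ ≤ ∫ r in s, q g * (1 + (z.2 + r) ^ 2)⁻¹ :=
        norm_integral_le_of_norm_le
          ((integrable_inv_one_add_add_sq z.2).const_mul _).restrict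
          ((ae_restrict_iff' hs).2 (.of_forall hb))
    _ ≤ ∫ r, q g * (1 + (z.2 + r) ^ 2)⁻¹ :=
        setIntegral_le_integral ((integrable_inv_one_add_add_sq z.2).const_mul _)
          (.of_forall fun r => by positivity)
    _ = q g * Real.pi := by
        rw [integral_const_mul, integral_add_left_eq_self (fun r => (1 + r ^ 2)⁻¹) z.2,
          integral_univ_inv_one_add_sq]

theorem fiberIntegral_Iic_eq_neg {F : Type} [NormedAddCommGroup F] [NormedSpace ℝ F]
    (g : fiberLizorkin V F) (z : V × ℝ) :
    fiberIntegral (Set.Iic 0) g.1 z = -fiberIntegral (Set.Ioi 0) g.1 z := by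
  have h1 : fiberIntegral Set.univ g.1 z = 0 := by
    rw [fiberIntegral_univ]; simpa using g.2 z.1 0
  rw [eq_neg_iff_add_eq_zero, ← h1, fiberIntegral, fiberIntegral, fiberIntegral, setIntegral_univ,
    intervalIntegral.integral_Iic_add_Ioi (integrable_fiber g.1 z).integrableOn
      (integrable_fiber g.1 z).integrableOn]

/-- For $p\le0$ the primitive is a tail integral from $-\infty$; for $p\ge0$ the vanishing zeroth
moment turns it into minus the tail to $+\infty$. Both tails decay rapidly, and derivatives reduce
to primitives of derivatives. -/
theorem exists_bound_iteratedFDeriv_primitive (l : ℕ) : ∀ {F : Type} [NormedAddCommGroup F]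
    [NormedSpace ℝ F] [CompleteSpace F] (k : ℕ), ∃ q : fiberLizorkin V F → ℝ,
      Continuous q ∧ q 0 = 0 ∧ ∀ g z,
        ‖z‖ ^ k * ‖iteratedFDeriv ℝ l (fiberIntegral (Set.Iic 0) g.1) z‖ ≤ q g := by
  induction l with
  | zero =>
    intro F _ _ _ k
    obtain ⟨q, hq, hq0, h⟩ := exists_bound_fiberIntegral (V := V) (F := F) k
    refine ⟨fun g => q g.1, by fun_prop, hq0, fun g z => ?_⟩
    rw [norm_iteratedFDeriv_zero]
    rcases le_total z.2 0 with hz | hz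
    · refine h g.1 _ z measurableSet_Iic fun r hr => ?_
      rw [abs_of_nonpos hz, abs_of_nonpos (add_nonpos hz hr)]
      linarith [Set.mem_Iic.1 hr]
    · rw [fiberIntegral_Iic_eq_neg, norm_neg]
      refine h g.1 _ z measurableSet_Ioi fun r hr => ?_
      have := Set.mem_Ioi.1 hr
      rw [abs_of_nonneg hz, abs_of_nonneg (by linarith)]
      linarith
  | succ l ih =>
    intro F _ _ _ k
    obtain ⟨q, hq, hq0, h⟩ := ih (F := V × ℝ →L[ℝ] F) k
    refine ⟨fun g => q (fiberFDeriv V F g), by fun_prop, by simp [hq0], fun g z => ?_⟩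
    rw [← norm_iteratedFDeriv_fderiv, fderiv_fiberIntegral]
    exact h (fiberFDeriv V F g) z

variable {F : Type} [NormedAddCommGroup F] [NormedSpace ℝ F] [CompleteSpace F]

/-- `fiberPrimitive` before restricting the codomain. -/
def fiberPrimitiveAux (V F : Type) [NormedAddCommGroup V] [NormedSpace ℝ V]
    [NormedAddCommGroup F] [NormedSpace ℝ F] [CompleteSpace F] :
    fiberLizorkin V F →L[ℝ] 𝓢(V × ℝ, F) :=
  schwartzMkCLM (𝕜 := ℝ)
    { toFun := fun g => fiberIntegral (Set.Iic 0) g.1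
      map_add' := fun f g => by
        funext z
        exact integral_add (integrable_fiber f.1 z).restrict (integrable_fiber g.1 z).restrict
      map_smul' := fun c g => by
        funext z
        exact integral_smul c _ }
    (fun g => contDiff_infty.2 fun m => contDiff_fiberIntegral _ m g.1)
    (fun k l => exists_bound_iteratedFDeriv_primitive l k)

theorem fderiv_fiberPrimitiveAux (g : fiberLizorkin V F) (z : V × ℝ) :
    fderiv ℝ (fiberPrimitiveAux V F g) z (0, 1) = g.1 z := by
  have h : ⇑(fiberPrimitiveAux V F g) = fiberIntegral (Set.Iic 0) g.1 := rfl
  rw [h, fderiv_fiberIntegral, fiberIntegral, ContinuousLinearMap.integral_apply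
    (integrable_fiber _ z).restrict]
  have h1 := integral_Iic_of_hasDerivAt_of_tendsto' (a := 0)
    (fun q _ => fderiv_slice g.1 z q) (integrable_fderiv_slice g.1 z).integrableOn
    (tendsto_zero_of_hasDerivAt_of_integrableOn_Iic (a := 0) (fun q _ => fderiv_slice g.1 z q)
    (integrable_fderiv_slice g.1 z).integrableOn (integrable_fiber g.1 z).integrableOn)
  have h2 : z + (0, 0) = z := add_zero z
  rw [sub_zero, h2] at h1
  exact h1

/-- Integrating $\partial_p(p^{k+1}G)=p^{k+1}g+(k+1)p^kG$ over the fibre expresses the $k$-th moment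
of $G$ through a moment of $g$. -/
theorem fiberPrimitiveAux_mem (g : fiberLizorkin V F) :
    fiberPrimitiveAux V F g ∈ fiberLizorkin V F := by
  intro y k
  have h0 := integral_fderiv_slice (fiberPow (k + 1) (fiberPrimitiveAux V F g)) y
  have h2 : ∀ p : ℝ, fderiv ℝ (fiberPow (k + 1) (fiberPrimitiveAux V F g)) (y, p) (0, 1) =
      p ^ (k + 1) • g.1 (y, p) + (k + 1 : ℝ) • p ^ k • fiberPrimitiveAux V F g (y, p) := by
    intro p
    rw [fderiv_fiberPow, ← fderiv_fiberPrimitiveAux]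
    simp [smul_smul]
  simp only [h2] at h0
  rw [integral_add (integrable_pow_smul_slice _ _ y) ((integrable_pow_smul_slice _ _ y).fun_smul _),
    integral_smul, g.2, zero_add] at h0
  exact (smul_eq_zero.1 h0).resolve_left (by positivity)

/-- The primitive along the fibres, `(y, p) ↦ ∫_{q ≤ p} g (y, q) dq`. -/
def fiberPrimitive (V F : Type) [NormedAddCommGroup V] [NormedSpace ℝ V]
    [NormedAddCommGroup F] [NormedSpace ℝ F] [CompleteSpace F] :
    fiberLizorkin V F →L[ℝ] fiberLizorkin V F :=
  (fiberPrimitiveAux V F).codRestrict _ fiberPrimitiveAux_mem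

theorem fderiv_fiberPrimitive (g : fiberLizorkin V F) (z : V × ℝ) :
    fderiv ℝ (fiberPrimitive V F g).1 z (0, 1) = g.1 z := fderiv_fiberPrimitiveAux g z

theorem fiberPrimitive_eq_zero (g : fiberLizorkin V F) {y : V} (h : ∀ p, g.1 (y, p) = 0) (p : ℝ) :
    (fiberPrimitive V F g).1 (y, p) = 0 := by
  change fiberIntegral (Set.Iic 0) g.1 (y, p) = 0
  simp [fiberIntegral, h]

end Primitive

/-! ### The average over the hyperplanes through a point -/

section DualRadon

variable {V F : Type} [NormedAddCommGroup V] [InnerProductSpace ℝ V] [NormedAddCommGroup F]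
  [NormedSpace ℝ F]

/-- The graph `y ↦ (y, ⟪x, y⟫)`. -/
def innerGraph (x : V) : V →L[ℝ] V × ℝ := (ContinuousLinearMap.id ℝ V).prod (innerSL ℝ x)

theorem innerGraph_apply (x y : V) : innerGraph x y = (y, inner ℝ x y) := rfl

/-- The restriction of `g` to the hyperplane `{(y, p) | p = ⟪x, y⟫}`. -/
def graphRestrict (x : V) : 𝓢(V × ℝ, F) →L[ℝ] 𝓢(V, F) :=
  SchwartzMap.compCLM ℝ (innerGraph x).hasTemperateGrowth ⟨1, 1, fun y => by
    have : ‖y‖ ≤ ‖innerGraph x y‖ := norm_fst_le (innerGraph x y)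
    rw [one_mul, pow_one]; linarith⟩

/-- The operator that corresponds to the derivative under `dualRadon`. -/
def dualRadonDeriv (V F : Type) [NormedAddCommGroup V] [InnerProductSpace ℝ V]
    [NormedAddCommGroup F] [NormedSpace ℝ F] [CompleteSpace F] :
    fiberLizorkin V F →L[ℝ] fiberLizorkin V (V →L[ℝ] F) :=
  (fiberBilin (ContinuousLinearMap.hasTemperateGrowth
    (((ContinuousLinearMap.compL ℝ V (V × ℝ) F).flip).comp
      ((ContinuousLinearMap.compL ℝ V ℝ (V × ℝ) (ContinuousLinearMap.inr ℝ V ℝ)).comp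
        (innerSL ℝ))))).comp (fiberFDeriv V F)

/-- The operator that corresponds to multiplication by `-⟪x, ·⟫` under `dualRadon`. -/
def dualRadonMul (V F : Type) [NormedAddCommGroup V] [InnerProductSpace ℝ V]
    [NormedAddCommGroup F] [NormedSpace ℝ F] [CompleteSpace F] :
    fiberLizorkin V F →L[ℝ] fiberLizorkin V (V →L[ℝ] F) :=
  (fiberBilin (Function.HasTemperateGrowth.const
    ((ContinuousLinearMap.compL ℝ V (V × ℝ) F).flip (ContinuousLinearMap.inl ℝ V ℝ)))).comp
    ((fiberFDeriv V F).comp (fiberPrimitive V F))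

theorem dualRadonMul_apply [CompleteSpace F] (g : fiberLizorkin V F) (z : V × ℝ) (v : V) :
    (dualRadonMul V F g).1 z v = fderiv ℝ (fiberPrimitive V F g).1 z (v, 0) := rfl

variable [FiniteDimensional ℝ V] [MeasurableSpace V] [BorelSpace V]

theorem integral_fderiv_schwartz (f : 𝓢(V, F)) (v : V) : ∫ x, fderiv ℝ f x v = 0 := by
  have hi : Integrable fun x => fderiv ℝ f x v :=
    (SchwartzMap.fderivCLM ℝ V F f).integrable.apply_continuousLinearMap v
  have := integral_smul_fderiv_eq_neg_fderiv_smul_of_integrable (μ := volume) (𝕜 := ℝ)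
    (f := fun _ : V => (1 : ℝ)) (g := f) (v := v) (by simp) (by simpa using hi)
    (by simpa using f.integrable) (fun _ _ => by fun_prop) (fun x _ => f.differentiableAt)
  simpa using this

/-- The weight involves only the base variable, so it is integrable over every graph $p=\langle
x,y\rangle$, uniformly in $x$. This permits domination on the whole space when differentiating in
$x$. -/
theorem exists_bound_fst :
    ∃ q : 𝓢(V × ℝ, F) → ℝ, Continuous q ∧ q 0 = 0 ∧ ∀ g z, ‖g z‖ ≤
      q g * (1 + ‖z.1‖) ^ (-((volume : Measure V).integrablePower : ℝ)) := by
  set N := (volume : Measure V).integrablePower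
  refine ⟨fun g => 2 ^ (N - 1) * (SchwartzMap.seminorm ℝ 0 0 g + SchwartzMap.seminorm ℝ N 0 g),
    continuous_const.mul ((continuous_schwartz_seminorm 0 0).add
      (continuous_schwartz_seminorm N 0)), by simp, fun g z => ?_⟩
  rw [Real.rpow_neg (by positivity), Real.rpow_natCast, ← div_eq_mul_inv,
    le_div_iff₀ (by positivity)]
  have h1 := SchwartzMap.norm_le_seminorm ℝ g z
  have h2 := SchwartzMap.norm_pow_mul_le_seminorm ℝ g N z
  have h3 : (1 + ‖z.1‖) ^ N ≤ 2 ^ (N - 1) * (1 ^ N + ‖z‖ ^ N) :=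
    (pow_le_pow_left₀ (by positivity) (by gcongr; exact norm_fst_le z) N).trans
      (add_pow_le zero_le_one (norm_nonneg z) N)
  calc ‖g z‖ * (1 + ‖z.1‖) ^ N ≤ ‖g z‖ * (2 ^ (N - 1) * (1 ^ N + ‖z‖ ^ N)) := by gcongr
    _ = 2 ^ (N - 1) * (‖g z‖ + ‖z‖ ^ N * ‖g z‖) := by ring
    _ ≤ _ := mul_le_mul_of_nonneg_left (add_le_add h1 h2) (by positivity)

/-- The integral of `g (y, ⟪x, y⟫)` over `y`. -/
def dualRadon (g : 𝓢(V × ℝ, F)) (x : V) : F := ∫ y, g (y, inner ℝ x y)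

theorem exists_bound_dualRadon : ∃ q : 𝓢(V × ℝ, F) → ℝ, Continuous q ∧ q 0 = 0 ∧
    ∀ g x, ‖dualRadon g x‖ ≤ q g := by
  obtain ⟨q, hq, hq0, h⟩ := exists_bound_fst (V := V) (F := F)
  refine ⟨fun g => q g * ∫ y : V, (1 + ‖y‖) ^ (-((volume : Measure V).integrablePower : ℝ)),
    by fun_prop, by simp [hq0], fun g x => ?_⟩
  beta_reduce
  rw [← integral_const_mul]
  exact norm_integral_le_of_norm_le
    ((Measure.integrable_pow_neg_integrablePower (volume : Measure V)).const_mul _)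
    (.of_forall fun y => h g _)

variable [CompleteSpace F]

theorem hasFDerivAt_dualRadon (g : fiberLizorkin V F) (x : V) :
    HasFDerivAt (dualRadon g.1) (dualRadon (dualRadonDeriv V F g).1 x) x := by
  obtain ⟨q, -, -, h⟩ := exists_bound_fst (V := V) (F := V →L[ℝ] F)
  refine hasFDerivAt_integral_of_dominated_of_fderiv_le (s := Set.univ)
    (F := fun x y => g.1 (y, inner ℝ x y))
    (F' := fun x y => (dualRadonDeriv V F g).1 (y, inner ℝ x y))
    Filter.univ_mem (.of_forall fun w => (Continuous.aestronglyMeasurable (by fun_prop)))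
    (graphRestrict x g.1).integrable (Continuous.aestronglyMeasurable (by fun_prop))
    (.of_forall fun y w _ => h _ _)
    ((Measure.integrable_pow_neg_integrablePower (volume : Measure V)).const_mul _)
    (.of_forall fun y w _ => ?_)
  have h1 : HasFDerivAt (fun x : V => (y, inner ℝ x y))
      ((ContinuousLinearMap.inr ℝ V ℝ).comp (innerSL ℝ y)) w := by
    have h2 : HasFDerivAt (fun x : V => inner ℝ x y) (innerSL ℝ y) w := by
      simp_rw [real_inner_comm y]
      exact (innerSL ℝ y).hasFDerivAt
    exact (hasFDerivAt_const y w).prodMk h2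
  exact (g.1.hasFDerivAt _).comp w h1

theorem fderiv_dualRadon (g : fiberLizorkin V F) :
    fderiv ℝ (dualRadon g.1) = dualRadon (dualRadonDeriv V F g).1 :=
  funext fun x => (hasFDerivAt_dualRadon g x).fderiv

theorem contDiff_dualRadon (m : ℕ) : ∀ {F : Type} [NormedAddCommGroup F] [NormedSpace ℝ F]
    [CompleteSpace F] (g : fiberLizorkin V F), ContDiff ℝ m (dualRadon g.1) := by
  induction m with
  | zero =>
    intro F _ _ _ g
    exact contDiff_zero.2 (continuous_iff_continuousAt.2 fun x =>
      (hasFDerivAt_dualRadon g x).continuousAt)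
  | succ m ih =>
    intro F _ _ _ g
    push_cast
    rw [contDiff_succ_iff_fderiv]
    refine ⟨fun x => (hasFDerivAt_dualRadon g x).differentiableAt, by simp, ?_⟩
    rw [fderiv_dualRadon]
    exact ih _

/-- With $G$ the fibre primitive, the derivative of $y\mapsto G(y,\langle x,y\rangle)$ along $v$ is
$\partial_vG+\langle x,v\rangle g$ on the graph, and its integral is zero. -/
theorem dualRadon_dualRadonMul (g : fiberLizorkin V F) (x v : V) :
    dualRadon (dualRadonMul V F g).1 x v = -(inner ℝ x v • dualRadon g.1 x) := by
  have h0 := integral_fderiv_schwartz (graphRestrict x (fiberPrimitive V F g).1) v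
  have h1 : ∀ y, fderiv ℝ (graphRestrict x (fiberPrimitive V F g).1) y v =
      (dualRadonMul V F g).1 (y, inner ℝ x y) v + inner ℝ x v • g.1 (y, inner ℝ x y) := by
    intro y
    have h2 : HasFDerivAt (graphRestrict x (fiberPrimitive V F g).1)
        ((fderiv ℝ (fiberPrimitive V F g).1 (innerGraph x y)).comp (innerGraph x)) y :=
      ((fiberPrimitive V F g).1.hasFDerivAt _).comp y (innerGraph x).hasFDerivAt
    rw [h2.fderiv, dualRadonMul_apply, ← fderiv_fiberPrimitive, ← map_smul,
      ContinuousLinearMap.comp_apply, innerGraph_apply, innerGraph_apply, ← map_add]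
    simp
  simp only [h1] at h0
  have h3 : Integrable fun y => (dualRadonMul V F g).1 (y, inner ℝ x y) :=
    (graphRestrict x (dualRadonMul V F g).1).integrable
  have h4 : Integrable fun y => g.1 (y, inner ℝ x y) := (graphRestrict x g.1).integrable
  rw [integral_add (h3.apply_continuousLinearMap v)
    (h4.fun_smul (inner ℝ x v)), integral_smul,
    ← ContinuousLinearMap.integral_apply h3] at h0
  exact eq_neg_of_add_eq_zero_left h0

theorem norm_dualRadon_dualRadonMul (g : fiberLizorkin V F) (x : V) :
    ‖dualRadon (dualRadonMul V F g).1 x‖ = ‖x‖ * ‖dualRadon g.1 x‖ := by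
  have : dualRadon (dualRadonMul V F g).1 x = -((innerSL ℝ x).smulRight (dualRadon g.1 x)) := by
    ext v
    rw [dualRadon_dualRadonMul]
    rfl
  rw [this, norm_neg, ContinuousLinearMap.norm_smulRight_apply, innerSL_apply_norm]

/-- Each factor $\|x\|$ is traded for one application of `dualRadonMul`, at the price of a larger
target space. -/
theorem exists_bound_pow_mul_dualRadon (k : ℕ) : ∀ {F : Type} [NormedAddCommGroup F]
    [NormedSpace ℝ F] [CompleteSpace F], ∃ q : fiberLizorkin V F → ℝ, Continuous q ∧ q 0 = 0 ∧
      ∀ g x, ‖x‖ ^ k * ‖dualRadon g.1 x‖ ≤ q g := by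
  induction k with
  | zero =>
    intro F _ _ _
    obtain ⟨q, hq, hq0, h⟩ := exists_bound_dualRadon (V := V) (F := F)
    exact ⟨fun g => q g.1, by fun_prop, hq0, fun g x => by simpa using h g.1 x⟩
  | succ k ih =>
    intro F _ _ _
    obtain ⟨q, hq, hq0, h⟩ := ih (F := V →L[ℝ] F)
    refine ⟨fun g => q (dualRadonMul V F g), by fun_prop, by simp [hq0], fun g x => ?_⟩
    rw [pow_succ, mul_assoc, ← norm_dualRadon_dualRadonMul]
    exact h _ x

theorem exists_bound_iteratedFDeriv_dualRadon (l k : ℕ) : ∀ {F : Type} [NormedAddCommGroup F]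
    [NormedSpace ℝ F] [CompleteSpace F], ∃ q : fiberLizorkin V F → ℝ, Continuous q ∧ q 0 = 0 ∧
      ∀ g x, ‖x‖ ^ k * ‖iteratedFDeriv ℝ l (dualRadon g.1) x‖ ≤ q g := by
  induction l with
  | zero =>
    intro F _ _ _
    simpa using exists_bound_pow_mul_dualRadon (V := V) k (F := F)
  | succ l ih =>
    intro F _ _ _
    obtain ⟨q, hq, hq0, h⟩ := ih (F := V →L[ℝ] F)
    refine ⟨fun g => q (dualRadonDeriv V F g), by fun_prop, by simp [hq0], fun g x => ?_⟩
    rw [← norm_iteratedFDeriv_fderiv, fderiv_dualRadon]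
    exact h _ x

/-- `dualRadon` as a continuous linear map into the Schwartz functions. -/
def dualRadonCLM (V F : Type) [NormedAddCommGroup V] [InnerProductSpace ℝ V]
    [FiniteDimensional ℝ V] [MeasurableSpace V] [BorelSpace V] [NormedAddCommGroup F]
    [NormedSpace ℝ F] [CompleteSpace F] : fiberLizorkin V F →L[ℝ] 𝓢(V, F) :=
  schwartzMkCLM (𝕜 := ℝ)
    { toFun := fun g => dualRadon g.1
      map_add' := fun f g => by
        funext x
        exact integral_add (graphRestrict x f.1).integrable (graphRestrict x g.1).integrable
      map_smul' := fun c g => by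
        funext x
        exact integral_smul c _ }
    (fun g => contDiff_infty.2 fun m => contDiff_dualRadon m g)
    (fun k l => exists_bound_iteratedFDeriv_dualRadon l k)

end DualRadon

/-! ### Moments of the averages -/

/-- A bump function equal to `1` near `2`, supported in `[1, 3]`. -/
def radialBump : ContDiffBump (2 : ℝ) := ⟨1 / 2, 1, by norm_num, by norm_num⟩

/-- A bump function equal to `1` on `[3/4, 13/4]`, supported in `[1/2, 7/2]`. -/
def widerBump : ContDiffBump (2 : ℝ) := ⟨5 / 4, 3 / 2, by norm_num, by norm_num⟩

theorem contDiff_widerBump_mul {f : ℝ → ℝ} (hf : ∀ t, t ≠ 0 → ContDiffAt ℝ ∞ f t) :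
    ContDiff ℝ ∞ fun t => widerBump t * f t := by
  rw [contDiff_iff_contDiffAt]
  intro t
  rcases eq_or_ne t 0 with rfl | ht
  · have : (fun t => widerBump t * f t) =ᶠ[nhds 0] fun _ => 0 := by
      filter_upwards [gt_mem_nhds (show (0 : ℝ) < 1 / 2 by norm_num)] with t ht
      rw [widerBump.zero_of_le_dist, zero_mul]
      rw [Real.dist_eq, abs_of_neg (by linarith)]
      simp only [widerBump]
      linarith
    exact contDiffAt_const.congr_of_eventuallyEq this
  · exact widerBump.contDiff.contDiffAt.mul (hf t ht)

theorem widerBump_of_mem {t : ℝ} (h1 : 3 / 4 ≤ t) (h3 : t ≤ 13 / 4) : widerBump t = 1 := by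
  rw [widerBump.one_of_mem_closedBall]
  rw [Metric.mem_closedBall, Real.dist_eq, abs_le]
  constructor <;> simp only [widerBump] <;> linarith

theorem widerBump_of_lt {t : ℝ} (h : 4 < t) : widerBump t = 0 := by
  rw [widerBump.zero_of_le_dist]
  rw [Real.dist_eq, abs_of_pos (by linarith)]
  simp only [widerBump]
  linarith

theorem hasTemperateGrowth_widerBump_mul {f : ℝ → ℝ} (hf : ∀ t, t ≠ 0 → ContDiffAt ℝ ∞ f t)
    (n : ℕ) : Function.HasTemperateGrowth
      fun y : E n => widerBump (‖y‖ ^ 2) * f (‖y‖ ^ 2) := by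
  refine HasCompactSupport.hasTemperateGrowth ?_
    ((contDiff_widerBump_mul hf).comp (contDiff_norm_sq ℝ))
  refine HasCompactSupport.intro (isCompact_closedBall (0 : E n) 2) fun y hy => ?_
  rw [mem_closedBall_zero_iff, not_le] at hy
  rw [widerBump_of_lt (by nlinarith), zero_mul]

section Moments

variable {n : ℕ}

/-- The annulus `{y | 1 ≤ |y|² ≤ 3}`. -/
def annulus (n : ℕ) : Set (E n) := {y | ‖y‖ ^ 2 ∈ Set.Icc (1 : ℝ) 3}

theorem isClosed_annulus : IsClosed (annulus n) :=
  isClosed_Icc.preimage (by fun_prop : Continuous fun y : E n => ‖y‖ ^ 2)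

theorem ne_zero_of_mem_annulus {y : E n} (hy : y ∈ annulus n) : y ≠ 0 := by
  rintro rfl
  have := hy.1
  norm_num at this

/-- The coordinates of a vector field equal to `y / |y|²` on the annulus. -/
def inversionField (i : Fin n) (y : E n) : ℝ := widerBump (‖y‖ ^ 2) * (‖y‖ ^ 2)⁻¹ * y i

theorem hasTemperateGrowth_inversionField (i : Fin n) :
    Function.HasTemperateGrowth (inversionField i) :=
  (hasTemperateGrowth_widerBump_mul (fun _ ht => contDiffAt_inv ℝ ht) n).mul
    (EuclideanSpace.proj i : E n →L[ℝ] ℝ).hasTemperateGrowth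

theorem sum_mul_inversionField {y : E n} (hy : y ∈ annulus n) :
    ∑ i, y i * inversionField i y = 1 := by
  have h1 : ∑ i, y i * inversionField i y =
      widerBump (‖y‖ ^ 2) * (‖y‖ ^ 2)⁻¹ * ∑ i, y i ^ 2 := by
    rw [Finset.mul_sum]
    exact Finset.sum_congr rfl fun i _ => by rw [inversionField]; ring
  rw [h1, ← EuclideanSpace.real_norm_sq_eq,
    widerBump_of_mem (by linarith [hy.1]) (by linarith [hy.2]), one_mul,
    inv_mul_cancel₀ (by linarith [hy.1])]

variable {F : Type} [NormedAddCommGroup F] [NormedSpace ℝ F]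

/-- The functions in `fiberLizorkin` supported in `annulus × ℝ`. -/
def annularLizorkin (n : ℕ) (F : Type) [NormedAddCommGroup F] [NormedSpace ℝ F] :
    Submodule ℝ (fiberLizorkin (E n) F) where
  carrier := {g | ∀ y ∉ annulus n, ∀ p, g.1 (y, p) = 0}
  zero_mem' := by intro y _ p; rfl
  add_mem' := by
    intro f g hf hg y hy p
    change f.1 (y, p) + g.1 (y, p) = 0
    rw [hf y hy, hg y hy, add_zero]
  smul_mem' := by
    intro c f hf y hy p
    change c • f.1 (y, p) = 0
    rw [hf y hy, smul_zero]

theorem fderiv_eq_zero_of_notMem_annulus {g : fiberLizorkin (E n) F}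
    (hg : g ∈ annularLizorkin n F) {y : E n} (hy : y ∉ annulus n) (p : ℝ) :
    fderiv ℝ g.1 (y, p) = 0 := by
  have h : g.1 =ᶠ[nhds (y, p)] fun _ => (0 : F) := by
    have : {z : E n × ℝ | z.1 ∉ annulus n} ∈ nhds (y, p) :=
      (isClosed_annulus.isOpen_compl.preimage continuous_fst).mem_nhds hy
    filter_upwards [this] with z hz
    exact hg z.1 hz z.2
  rw [h.fderiv_eq]
  simp

variable [CompleteSpace F]

/-- Evaluation of operator-valued functions at a vector. -/
def fiberEval {V : Type} [NormedAddCommGroup V] [NormedSpace ℝ V] (v : V) :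
    fiberLizorkin V (V →L[ℝ] F) →L[ℝ] fiberLizorkin V F :=
  fiberBilin (Function.HasTemperateGrowth.const (ContinuousLinearMap.apply ℝ F v))

theorem dualRadon_fiberEval (v x : E n) (g : fiberLizorkin (E n) (E n →L[ℝ] F)) :
    dualRadon (fiberEval v g).1 x = dualRadon g.1 x v := by
  have h3 : Integrable fun y => g.1 (y, inner ℝ x y) := (graphRestrict x g.1).integrable
  rw [dualRadon, dualRadon, ContinuousLinearMap.integral_apply h3]
  rfl

/-- The multipliers that map the averages of functions in `annularLizorkin` to such averages. -/
def dualRadonMultipliers (n : ℕ) (F : Type) [NormedAddCommGroup F] [NormedSpace ℝ F] :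
    Submonoid (E n → ℝ) where
  carrier := {P | ∀ g ∈ annularLizorkin n F, ∃ h ∈ annularLizorkin n F,
    ∀ x, P x • dualRadon g.1 x = dualRadon h.1 x}
  one_mem' := fun g hg => ⟨g, hg, fun x => by simp⟩
  mul_mem' := by
    intro P Q hP hQ g hg
    obtain ⟨h, hh, h1⟩ := hQ g hg
    obtain ⟨k, hk, h2⟩ := hP h hh
    exact ⟨k, hk, fun x => by rw [Pi.mul_apply, mul_smul, h1, h2]⟩

/-- Taking the primitive along fibres and then differentiating enlarges no support in the base
variable, so the annulus is preserved. -/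
theorem coord_mem_dualRadonMultipliers (i : Fin n) :
    (fun x : E n => x i) ∈ dualRadonMultipliers n F := by
  intro g hg
  refine ⟨-fiberEval (EuclideanSpace.single i 1) (dualRadonMul (E n) F g), neg_mem ?_,
    fun x => ?_⟩
  · intro y hy p
    change fderiv ℝ (fiberPrimitive (E n) F g).1 (y, p) _ = 0
    rw [fderiv_eq_zero_of_notMem_annulus _ hy]
    · rfl
    · exact fun y hy p => fiberPrimitive_eq_zero g (hg y hy) p
  · have h1 : ∀ g : fiberLizorkin (E n) F, dualRadon (-g).1 x = -dualRadon g.1 x := fun g =>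
      integral_neg _
    rw [h1, dualRadon_fiberEval, dualRadon_dualRadonMul, neg_neg, EuclideanSpace.inner_single_right]
    simp

/-- With $G_i=y_i|y|^{-2}G$ and $\partial_pG=g$, one has $g=\sum_iy_i\partial_pG_i$ on the annulus.
Since $y_i\partial_p$ under the average is $\partial_{x_i}$ of the average, the average of $g$ is a
divergence of Schwartz functions. The support away from $y=0$ makes the field $y/|y|^2$ admissible.
-/
theorem integral_dualRadon_eq_zero {g : fiberLizorkin (E n) F} (hg : g ∈ annularLizorkin n F) :
    ∫ x, dualRadon g.1 x = 0 := by
  have hθ : ∀ i : Fin n, Function.HasTemperateGrowth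
      fun y : E n => inversionField i y • ContinuousLinearMap.id ℝ F := fun i =>
    (hasTemperateGrowth_inversionField i).smul (.const _)
  let G : Fin n → fiberLizorkin (E n) F := fun i => fiberBilin (hθ i) (fiberPrimitive (E n) F g)
  have hG : ∀ i z, fderiv ℝ (G i).1 z (0, 1) = inversionField i z.1 • g.1 z := by
    intro i z
    have h1 := fderiv_slice (G i).1 z 0
    have h2 := (fderiv_slice (fiberPrimitive (E n) F g).1 z 0).const_smul (inversionField i z.1)
    have hz : z + ((0 : E n), (0 : ℝ)) = z := add_zero z
    rw [hz] at h1 h2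
    rw [← fderiv_fiberPrimitive g z]
    refine h1.unique (h2.congr_of_eventuallyEq (.of_forall fun q => ?_))
    change inversionField i (z.1 + 0) • (fiberPrimitive (E n) F g).1 (z + (0, q)) = _
    rw [add_zero]
    rfl
  have hS : ∀ x, dualRadon g.1 x = ∑ i, fderiv ℝ (dualRadonCLM (E n) F (G i)) x
      (EuclideanSpace.single i 1) := by
    intro x
    have h1 : ∀ i, fderiv ℝ (dualRadonCLM (E n) F (G i)) x (EuclideanSpace.single i 1) =
        ∫ y, (y i * inversionField i y) • g.1 (y, inner ℝ x y) := by
      intro i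
      have h3 : ⇑(dualRadonCLM (E n) F (G i)) = dualRadon (G i).1 := rfl
      rw [h3, fderiv_dualRadon, ← dualRadon_fiberEval]
      refine integral_congr_ae (.of_forall fun y => ?_)
      change fderiv ℝ (G i).1 _ (0, inner ℝ y _) = _
      have h4 : ((0 : E n), inner ℝ y (EuclideanSpace.single i (1 : ℝ))) = y i • (0, 1) := by
        rw [EuclideanSpace.inner_single_right]; simp
      rw [h4, map_smul, hG, smul_smul]
    have h5 : ∀ i, Integrable fun y : E n =>
        (y i * inversionField i y) • g.1 (y, inner ℝ x y) := by
      intro i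
      have ht : Function.HasTemperateGrowth fun y : E n => y i * inversionField i y :=
        (EuclideanSpace.proj i : E n →L[ℝ] ℝ).hasTemperateGrowth.mul
          (hasTemperateGrowth_inversionField i)
      have := (SchwartzMap.smulLeftCLM F (fun y : E n => y i * inversionField i y)
        (graphRestrict x g.1)).integrable (μ := volume)
      rwa [SchwartzMap.smulLeftCLM_apply ht] at this
    simp only [h1]
    rw [← integral_finsetSum _ fun i _ => h5 i]
    refine integral_congr_ae (.of_forall fun y => ?_)
    change _ = ∑ i, (y i * inversionField i y) • g.1 (y, inner ℝ x y)
    rw [← Finset.sum_smul]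
    by_cases hy : y ∈ annulus n
    · rw [sum_mul_inversionField hy, one_smul]
    · rw [hg y hy, smul_zero]
      exact hg y hy _
  simp only [hS]
  rw [integral_finsetSum]
  · exact Finset.sum_eq_zero fun i _ => integral_fderiv_schwartz _ _
  · exact fun i _ => ((SchwartzMap.fderivCLM ℝ (E n) F
      (dualRadonCLM (E n) F (G i))).integrable).apply_continuousLinearMap _

theorem integral_monomial_smul_dualRadon {g : fiberLizorkin (E n) F}
    (hg : g ∈ annularLizorkin n F) (m : Fin n → ℕ) :
    ∫ x : E n, (∏ i, x i ^ m i) • dualRadon g.1 x = 0 := by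
  have hm : (∏ i, (fun x : E n => x i) ^ m i) ∈ dualRadonMultipliers n F :=
    Submonoid.prod_mem _ fun i _ => Submonoid.pow_mem _ (coord_mem_dualRadonMultipliers i) _
  obtain ⟨h, hh, h1⟩ := hm g hg
  rw [← integral_dualRadon_eq_zero hh]
  refine integral_congr_ae (.of_forall fun x => ?_)
  have := h1 x
  simpa [Finset.prod_apply] using this

end Moments

/-! ### Composition with retractions onto the sphere -/

section Retraction

variable {n : ℕ}

/-- An open neighbourhood of the annulus and of the unit sphere. -/
def collar (n : ℕ) : Set (E n × ℝ) := {z | ‖z.1‖ ^ 2 ∈ Set.Ioo (3 / 4 : ℝ) (13 / 4)}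

theorem isOpen_collar : IsOpen (collar n) :=
  isOpen_Ioo.preimage (by fun_prop : Continuous fun z : E n × ℝ => ‖z.1‖ ^ 2)

theorem mem_collar_of_mem_annulus {z : E n × ℝ} (hz : z.1 ∈ annulus n) : z ∈ collar n :=
  ⟨by linarith [hz.1], by linarith [hz.2]⟩

theorem sphere_mem_collar (u : S n) (p : ℝ) : ((u : E n), p) ∈ collar n := by
  constructor <;> simp <;> norm_num

theorem fst_ne_zero_of_mem_collar {z : E n × ℝ} (hz : z ∈ collar n) : z.1 ≠ 0 := by
  intro h
  have := hz.1
  rw [h] at this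
  norm_num at this

theorem norm_fst_le_of_mem_collar {z : E n × ℝ} (hz : z ∈ collar n) : ‖z.1‖ ≤ 2 := by
  nlinarith [hz.2, norm_nonneg z.1]

/-- A smooth function equal to `‖y‖⁻¹` on the collar. -/
def cutoffInvNorm (y : E n) : ℝ := widerBump (‖y‖ ^ 2) * ((‖y‖ ^ 2)⁻¹ * √(‖y‖ ^ 2))

theorem hasTemperateGrowth_cutoffInvNorm (n : ℕ) :
    Function.HasTemperateGrowth (cutoffInvNorm (n := n)) :=
  hasTemperateGrowth_widerBump_mul (f := fun t => t⁻¹ * √t)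
    (fun _ ht => (contDiffAt_inv ℝ ht).mul (Real.contDiffAt_sqrt ht)) n

theorem cutoffInvNorm_of_mem {z : E n × ℝ} (hz : z ∈ collar n) :
    cutoffInvNorm z.1 = ‖z.1‖⁻¹ := by
  rw [cutoffInvNorm, widerBump_of_mem hz.1.le hz.2.le, one_mul, Real.sqrt_sq (norm_nonneg _)]
  have := norm_ne_zero_iff.2 (fst_ne_zero_of_mem_collar hz)
  field_simp

/-- Chain and Leibniz rules with constants independent of `h`. Temperate growth of `Ψ` and `χ` costs
only a polynomial factor, to be absorbed by a rapidly decreasing `M`. Serves both the lift from the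
cylinder and the homogeneous extension. -/
theorem exists_bound_iteratedFDeriv_smul_comp {Ψ : E n × ℝ → E n × ℝ} {χ : E n × ℝ → ℝ}
    (hΨ : Function.HasTemperateGrowth Ψ) (hχ : Function.HasTemperateGrowth χ)
    (hmaps : Set.MapsTo Ψ (collar n) {z | z.1 ≠ 0}) (l : ℕ) :
    ∃ (k : ℕ) (C : ℝ), 0 ≤ C ∧ ∀ h : E n × ℝ → ℂ, ContDiffOn ℝ ∞ h {z | z.1 ≠ 0} →
      ∀ z ∈ collar n, ∀ M : ℝ, (∀ i ≤ l, ‖iteratedFDeriv ℝ i h (Ψ z)‖ ≤ M) →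
        ‖iteratedFDeriv ℝ l (fun z => χ z • h (Ψ z)) z‖ ≤ C * (1 + ‖z‖) ^ k * M := by
  obtain ⟨k₁, C₁, hC₁, h₁⟩ := hΨ.norm_iteratedFDeriv_le_uniform l
  obtain ⟨k₂, C₂, hC₂, h₂⟩ := hχ.norm_iteratedFDeriv_le_uniform l
  -- The summand 1 ensures $D\ge1$, so that $D\le D^i$ for $i\ge1$ and $D^j\le D^l$ for $j\le l$.
  let D : E n × ℝ → ℝ := fun z => (1 + C₁) * (1 + ‖z‖) ^ k₁
  have hD1 : ∀ z, 1 ≤ D z := fun z =>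
    one_le_mul_of_one_le_of_one_le (by linarith) (one_le_pow₀ (by linarith [norm_nonneg z]))
  refine ⟨k₂ + k₁ * l, ∑ i ∈ Finset.range (l + 1), (l.choose i : ℝ) * C₂ *
    (l.factorial * (1 + C₁) ^ l), by positivity, fun h hh z hz M hM => ?_⟩
  have hM0 : 0 ≤ M := (norm_nonneg _).trans (hM 0 (Nat.zero_le _))
  have hs : IsOpen {z : E n × ℝ | z.1 ≠ 0} := isOpen_fst_ne
  have hU := isOpen_collar (n := n)
  have hcomp : ∀ j ≤ l, ‖iteratedFDerivWithin ℝ j (h ∘ Ψ) (collar n) z‖ ≤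
      l.factorial * M * D z ^ l := by
    intro j hj
    have := norm_iteratedFDerivWithin_comp_le (n := j) (N := ∞) hh hΨ.1.contDiffOn
      (by exact_mod_cast le_top) hs.uniqueDiffOn hU.uniqueDiffOn hmaps hz (C := M) (D := D z)
      (fun i hi => by
        rw [iteratedFDerivWithin_of_isOpen i hs (hmaps hz)]
        exact hM i (hi.trans hj))
      (fun i hi1 hi => by
        rw [iteratedFDerivWithin_of_isOpen i hU hz]
        refine (h₁ i (hi.trans hj) z).trans ?_
        refine le_trans ?_ (le_self_pow₀ (hD1 z) (by omega))
        change _ ≤ (1 + C₁) * (1 + ‖z‖) ^ k₁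
        gcongr
        linarith)
    refine this.trans ?_
    gcongr
    exact hD1 z
  rw [← iteratedFDerivWithin_of_isOpen l hU hz]
  refine (norm_iteratedFDerivWithin_smul_le (N := ∞) hχ.1.contDiffOn
    (hh.comp hΨ.1.contDiffOn hmaps) hU.uniqueDiffOn hz (by exact_mod_cast le_top)).trans ?_
  rw [Finset.sum_mul, Finset.sum_mul]
  refine Finset.sum_le_sum fun i hi => ?_
  have hil : i ≤ l := Nat.lt_succ_iff.1 (Finset.mem_range.1 hi)
  have e1 : ‖iteratedFDerivWithin ℝ i χ (collar n) z‖ ≤ C₂ * (1 + ‖z‖) ^ k₂ := by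
    rw [iteratedFDerivWithin_of_isOpen i hU hz]
    exact h₂ i hil z
  calc _ ≤ (l.choose i : ℝ) * (C₂ * (1 + ‖z‖) ^ k₂) * (l.factorial * M * D z ^ l) := by
        gcongr
        exact hcomp _ (Nat.sub_le _ _)
    _ = _ := by
        simp only [D]
        rw [mul_pow, ← pow_mul, pow_add]
        ring

/-- A smooth map equal to `(y, p) ↦ (y / |y|, p / |y|)` on the collar. -/
def normalize (z : E n × ℝ) : E n × ℝ := cutoffInvNorm z.1 • z

/-- A smooth map equal to `(y, p) ↦ (y / |y|, p)` on the collar. -/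
def normalizeFst (z : E n × ℝ) : E n × ℝ := (cutoffInvNorm z.1 • z.1, z.2)

theorem hasTemperateGrowth_cutoffInvNorm_fst :
    Function.HasTemperateGrowth fun z : E n × ℝ => cutoffInvNorm z.1 :=
  (hasTemperateGrowth_cutoffInvNorm n).comp (ContinuousLinearMap.fst ℝ (E n) ℝ).hasTemperateGrowth

theorem hasTemperateGrowth_normalize : Function.HasTemperateGrowth (normalize (n := n)) :=
  hasTemperateGrowth_cutoffInvNorm_fst.smul .id

theorem hasTemperateGrowth_normalizeFst : Function.HasTemperateGrowth (normalizeFst (n := n)) := by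
  have h1 := (ContinuousLinearMap.inl ℝ (E n) ℝ).hasTemperateGrowth.comp
    (hasTemperateGrowth_cutoffInvNorm_fst.smul
      (ContinuousLinearMap.fst ℝ (E n) ℝ).hasTemperateGrowth)
  have h2 := ((ContinuousLinearMap.inr ℝ (E n) ℝ).comp
    (ContinuousLinearMap.snd ℝ (E n) ℝ)).hasTemperateGrowth
  convert h1.add h2 using 1
  funext z
  ext <;> simp [normalizeFst]

/-- The radial projection onto the sphere. -/
def toSphere (y : E n) (h : y ≠ 0) : S n :=
  ⟨‖y‖⁻¹ • y, by simp [norm_smul, inv_mul_cancel₀ (norm_ne_zero_iff.mpr h)]⟩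

theorem normalize_of_mem {z : E n × ℝ} (hz : z ∈ collar n) :
    normalize z = ((toSphere z.1 (fst_ne_zero_of_mem_collar hz) : E n), ‖z.1‖⁻¹ * z.2) := by
  rw [normalize, cutoffInvNorm_of_mem hz]
  rfl

theorem normalizeFst_of_mem {z : E n × ℝ} (hz : z ∈ collar n) :
    normalizeFst z = ((toSphere z.1 (fst_ne_zero_of_mem_collar hz) : E n), z.2) := by
  rw [normalizeFst, cutoffInvNorm_of_mem hz]
  rfl

theorem sphere_ne_zero (u : S n) : (u : E n) ≠ 0 := by
  rw [← norm_ne_zero_iff]; simp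

theorem mapsTo_normalize : Set.MapsTo normalize (collar n) {z | z.1 ≠ 0} := fun z hz => by
  rw [normalize_of_mem hz]; exact sphere_ne_zero _

theorem mapsTo_normalizeFst : Set.MapsTo normalizeFst (collar n) {z | z.1 ≠ 0} := fun z hz => by
  rw [normalizeFst_of_mem hz]; exact sphere_ne_zero _

end Retraction

/-! ### Lifting functions on the cylinder to Schwartz functions -/

namespace SphereSchwartz

variable {n : ℕ}

theorem le_seminorm (ρ : SphereSchwartz n) (k l : ℕ) (u : S n) (p : ℝ) :
    |p| ^ k * ‖iteratedFDeriv ℝ l (homExt ρ.fn) ((u : E n), p)‖ ≤ seminorm n k l ρ :=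
  le_ciSup (ρ.bddAbove k l) (u, p)

theorem continuous_seminorm (k l : ℕ) : Continuous (seminorm n k l) :=
  (withSeminorms n).continuous_seminorm (k, l)

theorem exists_bound_one_add_pow (m l : ℕ) : ∃ q : SphereSchwartz n → ℝ, Continuous q ∧ q 0 = 0 ∧
    ∀ ρ (u : S n) (p : ℝ), ∀ i ≤ l,
      (1 + |p|) ^ m * ‖iteratedFDeriv ℝ i (homExt ρ.fn) ((u : E n), p)‖ ≤ q ρ := by
  refine ⟨fun ρ => ∑ i ∈ Finset.range (l + 1),
    2 ^ (m - 1) * (seminorm n 0 i ρ + seminorm n m i ρ), ?_, by simp, fun ρ u p i hi => ?_⟩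
  · exact continuous_finsetSum _ fun i _ => continuous_const.mul
      ((continuous_seminorm 0 i).add (continuous_seminorm m i))
  · refine le_trans ?_ (Finset.single_le_sum (f := fun i =>
      2 ^ (m - 1) * (seminorm n 0 i ρ + seminorm n m i ρ)) (fun j _ => by positivity)
      (Finset.mem_range.2 (Nat.lt_succ_of_le hi)))
    have h1 := le_seminorm ρ 0 i u p
    have h2 := le_seminorm ρ m i u p
    have h3 := add_pow_le zero_le_one (abs_nonneg p) m
    rw [pow_zero, one_mul] at h1
    calc _ ≤ 2 ^ (m - 1) * (1 ^ m + |p| ^ m) *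
          ‖iteratedFDeriv ℝ i (homExt ρ.fn) ((u : E n), p)‖ := by gcongr
      _ = 2 ^ (m - 1) * (‖iteratedFDeriv ℝ i (homExt ρ.fn) ((u : E n), p)‖ +
          |p| ^ m * ‖iteratedFDeriv ℝ i (homExt ρ.fn) ((u : E n), p)‖) := by ring
      _ ≤ _ := mul_le_mul_of_nonneg_left (add_le_add h1 h2) (by positivity)

/-- The function `(y, p) ↦ χ (y) ρ (y / |y|, p / |y|)`, with a radial cutoff `χ`. -/
def liftFun (ρ : SphereSchwartz n) (z : E n × ℝ) : ℂ :=
  radialBump (‖z.1‖ ^ 2) • homExt ρ.fn (normalize z)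

theorem liftFun_of_notMem {ρ : SphereSchwartz n} {z : E n × ℝ} (hz : z.1 ∉ annulus n) :
    liftFun ρ z = 0 := by
  rw [liftFun, radialBump.zero_of_le_dist, zero_smul]
  rw [Real.dist_eq]
  simp only [radialBump]
  by_contra! h
  rw [abs_lt] at h
  exact hz ⟨by linarith [h.1], by linarith [h.2]⟩

theorem liftFun_of_mem {ρ : SphereSchwartz n} {z : E n × ℝ} (hz : z ∈ collar n) :
    liftFun ρ z = radialBump (‖z.1‖ ^ 2) •
      ρ.fn (toSphere z.1 (fst_ne_zero_of_mem_collar hz)) (‖z.1‖⁻¹ * z.2) := by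
  rw [liftFun, normalize_of_mem hz, homExt_sphere]

theorem liftFun_eventuallyEq_zero {ρ : SphereSchwartz n} {z : E n × ℝ} (hz : z.1 ∉ annulus n) :
    liftFun ρ =ᶠ[nhds z] fun _ => 0 := by
  have : {z : E n × ℝ | z.1 ∉ annulus n} ∈ nhds z :=
    (isClosed_annulus.isOpen_compl.preimage continuous_fst).mem_nhds hz
  filter_upwards [this] with w hw
  exact liftFun_of_notMem hw

theorem hasTemperateGrowth_radialBump :
    Function.HasTemperateGrowth fun z : E n × ℝ => radialBump (‖z.1‖ ^ 2) := by
  have h : Function.HasTemperateGrowth radialBump :=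
    radialBump.hasCompactSupport.hasTemperateGrowth radialBump.contDiff
  exact (h.comp (Function.hasTemperateGrowth_norm_sq (E n))).comp
    (ContinuousLinearMap.fst ℝ (E n) ℝ).hasTemperateGrowth

theorem contDiff_liftFun (ρ : SphereSchwartz n) : ContDiff ℝ ∞ (liftFun ρ) := by
  rw [contDiff_iff_contDiffAt]
  intro z
  by_cases hz : z.1 ∈ annulus n
  · have h : ContDiffOn ℝ ∞ (liftFun ρ) (collar n) :=
      hasTemperateGrowth_radialBump.1.contDiffOn.smul
        (ContDiffOn.comp ρ.isSmooth hasTemperateGrowth_normalize.1.contDiffOn mapsTo_normalize)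
    exact h.contDiffAt (isOpen_collar.mem_nhds (mem_collar_of_mem_annulus hz))
  · exact contDiffAt_const.congr_of_eventuallyEq (liftFun_eventuallyEq_zero hz)

theorem exists_bound_liftFun (k l : ℕ) : ∃ q : SphereSchwartz n → ℝ, Continuous q ∧ q 0 = 0 ∧
    ∀ ρ z, ‖z‖ ^ k * ‖iteratedFDeriv ℝ l (liftFun ρ) z‖ ≤ q ρ := by
  obtain ⟨k₁, C, hC, h⟩ := exists_bound_iteratedFDeriv_smul_comp (n := n)
    hasTemperateGrowth_normalize hasTemperateGrowth_radialBump mapsTo_normalize l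
  -- The extra $k_1$ powers pay for the polynomial loss in the chain rule.
  obtain ⟨q, hq, hq0, hb⟩ := exists_bound_one_add_pow (n := n) (k + k₁) l
  refine ⟨fun ρ => C * 3 ^ (k + k₁) * |q ρ|, by fun_prop, by simp [hq0], fun ρ z => ?_⟩
  by_cases hz : z.1 ∈ annulus n
  · have hzc := mem_collar_of_mem_annulus hz
    set p := ‖z.1‖⁻¹ * z.2 with hp
    have hM : ∀ i ≤ l, ‖iteratedFDeriv ℝ i (homExt ρ.fn) (normalize z)‖ ≤
        ((1 + |p|) ^ (k + k₁))⁻¹ * |q ρ| := by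
      intro i hi
      rw [normalize_of_mem hzc, le_inv_mul_iff₀ (by positivity)]
      exact (hb ρ _ p i hi).trans (le_abs_self _)
    -- On the collar $|y|\le2$, so the norm of $z$ is controlled by the rescaled second coordinate.
    have hpz : 1 + ‖z‖ ≤ 3 * (1 + |p|) := by
      have hpos : 0 < ‖z.1‖ := norm_pos_iff.2 (fst_ne_zero_of_mem_collar hzc)
      have h2 : |z.2| = ‖z.1‖ * |p| := by
        rw [hp, abs_mul, abs_inv, abs_norm, ← mul_assoc, mul_inv_cancel₀ hpos.ne', one_mul]
      have h3 := norm_fst_le_of_mem_collar hzc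
      rw [Prod.norm_def, Real.norm_eq_abs, h2]
      have h4 : ‖z.1‖ * |p| ≤ 2 * |p| := by gcongr
      have := abs_nonneg p
      rcases max_choice ‖z.1‖ (‖z.1‖ * |p|) with e | e <;> rw [e] <;> linarith
    calc ‖z‖ ^ k * ‖iteratedFDeriv ℝ l (liftFun ρ) z‖
        ≤ (1 + ‖z‖) ^ k * (C * (1 + ‖z‖) ^ k₁ * (((1 + |p|) ^ (k + k₁))⁻¹ * |q ρ|)) := by
          gcongr
          · linarith
          · exact h _ ρ.isSmooth z hzc _ hM
      _ = C * (1 + ‖z‖) ^ (k + k₁) * ((1 + |p|) ^ (k + k₁))⁻¹ * |q ρ| := by ring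
      _ ≤ C * (3 * (1 + |p|)) ^ (k + k₁) * ((1 + |p|) ^ (k + k₁))⁻¹ * |q ρ| := by gcongr
      _ = C * 3 ^ (k + k₁) * |q ρ| := by
          rw [mul_pow]
          field_simp
  · rw [(liftFun_eventuallyEq_zero hz).iteratedFDeriv ℝ l |>.eq_of_nhds]
    simp only [iteratedFDeriv_fun_zero, Pi.zero_apply, norm_zero, mul_zero]
    positivity

/-- The lift to a Schwartz function on `ℝⁿ × ℝ`. -/
def lift (n : ℕ) : SphereSchwartz n →L[ℂ] 𝓢(E n × ℝ, ℂ) :=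
  schwartzMkCLM (𝕜 := ℂ)
    { toFun := liftFun
      map_add' := fun ρ σ => by
        funext z
        simp [liftFun, fn_add, homExt_add]
      map_smul' := fun c ρ => by
        funext z
        simp [liftFun, fn_smul, homExt_smul, mul_left_comm] }
    contDiff_liftFun exists_bound_liftFun

theorem lift_apply (ρ : SphereSchwartz n) (z : E n × ℝ) : lift n ρ z = liftFun ρ z := rfl

/-- On the fibre over $y$ the lift is a dilation of $\varrho(y/|y|,\cdot)$, and substituting
$p=|y|q$ only multiplies moments by constants. -/
theorem lift_mem_fiberLizorkin (ρ : sphereLizorkin n) :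
    lift n ρ.1 ∈ fiberLizorkin (E n) ℂ := by
  intro y k
  by_cases hy : y ∈ annulus n
  · have hyc : ∀ p, ((y, p) : E n × ℝ) ∈ collar n := fun p => mem_collar_of_mem_annulus hy
    have hy0 := ne_zero_of_mem_annulus hy
    have hn : ‖y‖ ≠ 0 := norm_ne_zero_iff.2 hy0
    set u := toSphere y hy0
    have h1 : ∀ p : ℝ, p ^ k • lift n ρ.1 (y, p) = (radialBump (‖y‖ ^ 2) * ‖y‖ ^ k) •
        (fun q : ℝ => (q : ℂ) ^ k * ρ.1.fn u q) (‖y‖⁻¹ * p) := by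
      intro p
      rw [lift_apply, liftFun_of_mem (hyc p)]
      simp only [Complex.real_smul, Complex.ofReal_mul, Complex.ofReal_pow, Complex.ofReal_inv]
      have hn' : (‖y‖ : ℂ) ≠ 0 := by exact_mod_cast hn
      have e : (‖y‖ : ℂ) ^ k * ((‖y‖ : ℂ)⁻¹ * p) ^ k = (p : ℂ) ^ k := by
        rw [← mul_pow, mul_inv_cancel_left₀ hn']
      rw [← e]
      ring
    simp only [h1]
    rw [integral_smul, Measure.integral_comp_mul_left (fun q : ℝ => (q : ℂ) ^ k * ρ.1.fn u q),
      ρ.2 u k, smul_zero, smul_zero]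
  · simp [lift_apply, liftFun_of_notMem (z := (y, _)) hy]

/-- The lift of a function with vanishing moments. -/
def liftLizorkin (ρ : sphereLizorkin n) : fiberLizorkin (E n) ℂ :=
  ⟨lift n ρ.1, lift_mem_fiberLizorkin ρ⟩

theorem continuous_liftLizorkin : Continuous (liftLizorkin (n := n)) :=
  ((lift n).continuous.comp continuous_subtype_val).subtype_mk _

theorem liftLizorkin_mem (ρ : sphereLizorkin n) : liftLizorkin ρ ∈ annularLizorkin n ℂ :=
  fun _ hy _ => liftFun_of_notMem hy

end SphereSchwartz

/-! ### Polar coordinates -/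

section Polar

variable {n : ℕ}

theorem integral_volumeIoiPow (k : ℕ) (f : ℝ → ℂ) :
    ∫ r : Set.Ioi (0 : ℝ), f r ∂(Measure.volumeIoiPow k) = ∫ r in Set.Ioi (0 : ℝ), r ^ k • f r := by
  simp only [Measure.volumeIoiPow, ENNReal.ofReal]
  rw [integral_withDensity_eq_integral_smul,
    integral_subtype_comap measurableSet_Ioi fun a ↦ Real.toNNReal (a ^ k) • f a,
    setIntegral_congr_fun measurableSet_Ioi fun x hx ↦ ?_]
  · rw [NNReal.smul_def, Real.coe_toNNReal _ (pow_nonneg hx.out.le _)]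
  · exact (measurable_subtype_coe.pow_const _).real_toNNReal

theorem integral_eq_integral_sphere [NeZero n] {f : E n → ℂ} (hf : Integrable f) :
    ∫ x, f x = ∫ u : S n, (∫ r in Set.Ioi (0 : ℝ), r ^ (n - 1) • f (r • (u : E n)))
      ∂((volume : Measure (E n)).toSphere) := by
  have hmp := (volume : Measure (E n)).measurePreserving_homeomorphUnitSphereProd
  have hemb := (homeomorphUnitSphereProd (E n)).measurableEmbedding
  let g : S n × Set.Ioi (0 : ℝ) → ℂ := fun z => f ((z.2 : ℝ) • (z.1 : E n))
  have hg : ∀ x : ({0}ᶜ : Set (E n)), g (homeomorphUnitSphereProd (E n) x) = f x := by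
    intro x
    have := congrArg Subtype.val ((homeomorphUnitSphereProd (E n)).symm_apply_apply x)
    rw [homeomorphUnitSphereProd_symm_apply_coe] at this
    exact congrArg f this
  have hint : Integrable g ((volume : Measure (E n)).toSphere.prod
      (Measure.volumeIoiPow (Module.finrank ℝ (E n) - 1))) := by
    rw [← hmp.integrable_comp_emb hemb]
    have h1 : g ∘ homeomorphUnitSphereProd (E n) = f ∘ Subtype.val := funext hg
    rw [h1, ← integrableOn_iff_comap_subtypeVal (measurableSet_singleton _).compl]
    exact hf.integrableOn
  have : Nontrivial (E n) := inferInstance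
  calc ∫ x, f x = ∫ x : ({(0)}ᶜ : Set (E n)), f x.1 ∂(volume.comap Subtype.val) := by
        rw [integral_subtype_comap (measurableSet_singleton _).compl f, restrict_compl_singleton]
    _ = ∫ z, g z ∂((volume : Measure (E n)).toSphere.prod
          (Measure.volumeIoiPow (Module.finrank ℝ (E n) - 1))) := by
        rw [← hmp.integral_comp hemb]
        exact integral_congr_ae (.of_forall fun x => (hg x).symm)
    _ = _ := by
        rw [integral_prod _ hint]
        refine integral_congr_ae (.of_forall fun u => ?_)
        have := integral_volumeIoiPow (n - 1) fun r => f (r • (u : E n))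
        rw [finrank_euclideanSpace_fin]
        exact this

/-- The radial mass of the cutoff. -/
def radialMass (n : ℕ) : ℝ := ∫ r in Set.Ioi (0 : ℝ), r ^ (n - 1) * radialBump (r ^ 2)

theorem radialMass_pos : 0 < radialMass n := by
  have hc : Continuous fun r : ℝ => r ^ (n - 1) * radialBump (r ^ 2) :=
    (continuous_pow _).mul (radialBump.continuous.comp (continuous_pow 2))
  have hs : HasCompactSupport fun r : ℝ => r ^ (n - 1) * radialBump (r ^ 2) := by
    refine HasCompactSupport.intro (isCompact_Icc (a := -2) (b := (2 : ℝ))) fun r hr => ?_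
    rw [radialBump.zero_of_le_dist, mul_zero]
    rw [Real.dist_eq]
    simp only [radialBump]
    by_contra! h
    rw [abs_lt] at h
    exact hr ⟨by nlinarith, by nlinarith⟩
  rw [radialMass, setIntegral_pos_iff_support_of_nonneg_ae _
    (hc.integrable_of_hasCompactSupport hs).integrableOn]
  -- For these $r$ the square lies in $[1.69,2.25]$, within $1/2$ of $2$, where the bump equals $1$.
  · refine lt_of_lt_of_le ?_ (measure_mono (s := Set.Ioo (1.3 : ℝ) 1.5) fun r hr => ⟨?_, ?_⟩)
    · rw [Real.volume_Ioo]; norm_num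
    · have h1 : (0 : ℝ) < r := by linarith [hr.1]
      have h2 : r ^ 2 ∈ Metric.closedBall (2 : ℝ) radialBump.rIn := by
        rw [Metric.mem_closedBall, Real.dist_eq, abs_le]
        simp only [radialBump]
        constructor <;> nlinarith [hr.1, hr.2]
      rw [Function.mem_support, radialBump.one_of_mem_closedBall h2, mul_one]
      positivity
    · exact lt_trans (by norm_num) hr.1
  · refine (ae_restrict_iff' measurableSet_Ioi).2 (.of_forall fun r hr => ?_)
    have := Set.mem_Ioi.1 hr
    exact mul_nonneg (by positivity) radialBump.nonneg

end Polar

/-! ### The dual Radon transform as a continuous linear map -/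

section BackProjection

variable {n : ℕ}

open SphereSchwartz

/-- The reason for $p/|y|$ in the lift: on the graph over $y=ru$ this quotient is $x\cdot u$, so the
radius survives only in the cutoff and the polar integral splits. -/
theorem liftFun_smul (ρ : SphereSchwartz n) (u : S n) {r : ℝ} (hr : 0 < r) (x : E n) :
    liftFun ρ (r • (u : E n), inner ℝ x (r • (u : E n))) =
      radialBump (r ^ 2) • ρ.fn u (inner ℝ x (u : E n)) := by
  have hn : ‖r • (u : E n)‖ = r := by
    rw [norm_smul, Real.norm_of_nonneg hr.le]; simp
  by_cases hz : r • (u : E n) ∈ annulus n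
  · have hzc := mem_collar_of_mem_annulus (z := (r • (u : E n), inner ℝ x (r • (u : E n)))) hz
    have h1 : toSphere (r • (u : E n)) (ne_zero_of_mem_annulus hz) = u := by
      ext1
      change ‖r • (u : E n)‖⁻¹ • r • (u : E n) = u
      rw [hn, inv_smul_smul₀ hr.ne']
    rw [liftFun_of_mem hzc]
    simp only [h1, hn, inner_smul_right, inv_mul_cancel_left₀ hr.ne']
  · have h0 := liftFun_of_notMem (ρ := ρ) (z := (r • (u : E n), inner ℝ x (r • (u : E n)))) hz
    have hb : radialBump (r ^ 2) = 0 := by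
      rw [radialBump.zero_of_le_dist]
      rw [Real.dist_eq]
      simp only [radialBump]
      by_contra! h
      rw [abs_lt] at h
      refine hz ⟨?_, ?_⟩ <;> rw [hn] <;> linarith [h.1, h.2]
    rw [h0, hb, zero_smul]

theorem dualRadon_liftLizorkin [NeZero n] (ρ : sphereLizorkin n) (x : E n) :
    dualRadon (liftLizorkin ρ).1 x = radialMass n • backProjection ρ.1.fn x := by
  have hint : Integrable fun y : E n => liftFun ρ.1 (y, inner ℝ x y) :=
    (graphRestrict x (liftLizorkin ρ).1).integrable
  have h0 : dualRadon (liftLizorkin ρ).1 x = ∫ y, liftFun ρ.1 (y, inner ℝ x y) := rfl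
  rw [h0, integral_eq_integral_sphere hint, backProjection, ← integral_smul]
  refine integral_congr_ae (.of_forall fun u => ?_)
  change ∫ r in Set.Ioi (0 : ℝ), r ^ (n - 1) • liftFun ρ.1 (r • (u : E n), _) = _ • _
  rw [radialMass, ← integral_smul_const]
  refine setIntegral_congr_fun measurableSet_Ioi fun r hr => ?_
  beta_reduce
  rw [liftFun_smul ρ.1 u hr, smul_smul]

/-- The dual Radon transform of a function with vanishing moments, as a Schwartz function. -/
def backProjectionSchwartz (ρ : sphereLizorkin n) : 𝓢(E n, ℂ) :=
  (radialMass n)⁻¹ • dualRadonCLM (E n) ℂ (liftLizorkin ρ)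

theorem backProjectionSchwartz_apply [NeZero n] (ρ : sphereLizorkin n) (x : E n) :
    backProjectionSchwartz ρ x = backProjection ρ.1.fn x := by
  change (radialMass n)⁻¹ • dualRadon (liftLizorkin ρ).1 x = _
  rw [dualRadon_liftLizorkin, inv_smul_smul₀ radialMass_pos.ne']

theorem backProjectionSchwartz_mem (ρ : sphereLizorkin n) :
    backProjectionSchwartz ρ ∈ lizorkin n := by
  intro m
  have h := integral_monomial_smul_dualRadon (liftLizorkin_mem ρ) m
  have h1 : ∀ x : E n, ((∏ i, x i ^ m i : ℝ) : ℂ) * backProjectionSchwartz ρ x =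
      (radialMass n)⁻¹ • (∏ i, x i ^ m i) • dualRadon (liftLizorkin ρ).1 x := by
    intro x
    rw [smul_comm]
    exact (Complex.real_smul).symm
  simp only [h1]
  rw [integral_smul, h, smul_zero]

theorem continuous_backProjectionSchwartz : Continuous (backProjectionSchwartz (n := n)) :=
  ((dualRadonCLM (E n) ℂ).continuous.comp continuous_liftLizorkin).const_smul
    (radialMass n)⁻¹

/-- The dual Radon transform `𝒮₀(𝕊ⁿ⁻¹ × ℝ) → 𝒮₀(ℝⁿ)`. -/
def backProjectionCLM (n : ℕ) [NeZero n] : sphereLizorkin n →L[ℂ] lizorkin n where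
  toFun ρ := ⟨backProjectionSchwartz ρ, backProjectionSchwartz_mem ρ⟩
  map_add' ρ σ := by
    have h : liftLizorkin (ρ + σ) = liftLizorkin ρ + liftLizorkin σ :=
      Subtype.ext ((lift n).map_add ρ.1 σ.1)
    refine Subtype.ext ?_
    change backProjectionSchwartz (ρ + σ) = backProjectionSchwartz ρ + backProjectionSchwartz σ
    rw [backProjectionSchwartz, h, map_add, smul_add]
    rfl
  map_smul' c ρ := by
    -- `dualRadonCLM` is only real-linear, so complex homogeneity is read off from the integral over
    -- the sphere.
    refine Subtype.ext (SchwartzMap.ext fun x => ?_)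
    change backProjectionSchwartz (c • ρ) x = c • backProjectionSchwartz ρ x
    rw [backProjectionSchwartz_apply, backProjectionSchwartz_apply, backProjection, backProjection,
      ← integral_smul]
    rfl
  cont := continuous_backProjectionSchwartz.subtype_mk _

theorem backProjectionCLM_apply [NeZero n] (ρ : sphereLizorkin n) (x : E n) :
    (backProjectionCLM n ρ : 𝓢(E n, ℂ)) x = backProjection ρ.1.fn x :=
  backProjectionSchwartz_apply ρ x

end BackProjection

/-! ### Schwartz functions that vanish to infinite order at the origin -/

/-- The weight in the bound for flat functions along rays. -/
def rayWeight {V : Type} [NormedAddCommGroup V] (j : ℤ) (x : V) : ℝ := ‖x‖ ^ (-j) + ‖x‖ ^ (-(j + 2))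

theorem rayWeight_nonneg {V : Type} [NormedAddCommGroup V] (j : ℤ) (x : V) : 0 ≤ rayWeight j x := by
  rw [rayWeight]; positivity

theorem continuousAt_rayWeight {V : Type} [NormedAddCommGroup V] (j : ℤ) {x : V} (hx : x ≠ 0) :
    ContinuousAt (rayWeight j) x :=
  (continuousAt_id.norm.zpow₀ _ (Or.inl (norm_ne_zero_iff.2 hx))).add
    (continuousAt_id.norm.zpow₀ _ (Or.inl (norm_ne_zero_iff.2 hx)))

section Flat

variable {V F G : Type} [NormedAddCommGroup V] [NormedSpace ℝ V] [NormedAddCommGroup F]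
  [NormedSpace ℝ F] [NormedAddCommGroup G] [NormedSpace ℝ G]

/-- All derivatives of `ψ` vanish at the origin. -/
def FlatAtZero (ψ : 𝓢(V, F)) : Prop := ∀ m : ℕ, iteratedFDeriv ℝ m ψ 0 = 0

theorem FlatAtZero.apply_zero {ψ : 𝓢(V, F)} (h : FlatAtZero ψ) : ψ 0 = 0 := by
  have := h 0
  rw [← norm_eq_zero, norm_iteratedFDeriv_zero, norm_eq_zero] at this
  exact this

theorem FlatAtZero.fderiv {ψ : 𝓢(V, F)} (h : FlatAtZero ψ) :
    FlatAtZero (SchwartzMap.fderivCLM ℝ V F ψ) := fun m => by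
  have h1 : ⇑(SchwartzMap.fderivCLM ℝ V F ψ) = _root_.fderiv ℝ ψ := rfl
  rw [← norm_eq_zero, h1, norm_iteratedFDeriv_fderiv, h, norm_zero]

theorem FlatAtZero.postcomp {ψ : 𝓢(V, F)} (h : FlatAtZero ψ) (L : F →L[ℝ] G) :
    FlatAtZero (SchwartzMap.postcompCLM L ψ) := fun m => by
  have h1 : ⇑(SchwartzMap.postcompCLM L ψ) = L ∘ ψ := rfl
  rw [← norm_le_zero_iff, h1]
  refine (L.norm_iteratedFDeriv_comp_left (ψ.contDiffAt ⊤) (n := m) (by exact_mod_cast le_top)).trans ?_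
  rw [h, norm_zero, mul_zero]

theorem FlatAtZero.add {ψ χ : 𝓢(V, F)} (h : FlatAtZero ψ) (h' : FlatAtZero χ) :
    FlatAtZero (ψ + χ) := fun m => by
  have h1 : ⇑(ψ + χ) = ⇑ψ + ⇑χ := rfl
  rw [h1, iteratedFDeriv_add_apply ((ψ.smooth m).contDiffAt) ((χ.smooth m).contDiffAt), h, h',
    add_zero]

/-- The Euler operator `ψ ↦ (y ↦ Dψ (y) y)`. -/
def eulerCLM (V F : Type) [NormedAddCommGroup V] [NormedSpace ℝ V] [NormedAddCommGroup F]
    [NormedSpace ℝ F] : 𝓢(V, F) →L[ℝ] 𝓢(V, F) :=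
  (SchwartzMap.bilinLeftCLM (ContinuousLinearMap.id ℝ (V →L[ℝ] F)) (g := fun y : V => y)
    Function.HasTemperateGrowth.id').comp (SchwartzMap.fderivCLM ℝ V F)

theorem FlatAtZero.euler {ψ : 𝓢(V, F)} (h : FlatAtZero ψ) : FlatAtZero (eulerCLM V F ψ) :=
  fun m => by
  have h1 : ⇑(eulerCLM V F ψ) = fun y => SchwartzMap.fderivCLM ℝ V F ψ y y := rfl
  rw [← norm_le_zero_iff, h1]
  refine (norm_iteratedFDeriv_clm_apply (N := ∞) ((SchwartzMap.fderivCLM ℝ V F ψ).smooth ⊤)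
    contDiff_id 0 (by exact_mod_cast le_top)).trans ?_
  refine (Finset.sum_eq_zero fun i _ => ?_).le
  rw [h.fderiv, norm_zero, mul_zero, zero_mul]

theorem seminorm_fderivCLM_le (m : ℕ) (ψ : 𝓢(V, F)) :
    SchwartzMap.seminorm ℝ 0 m (SchwartzMap.fderivCLM ℝ V F ψ) ≤
      SchwartzMap.seminorm ℝ 0 (m + 1) ψ := by
  refine SchwartzMap.seminorm_le_bound ℝ 0 m _ (by positivity) fun x => ?_
  have h1 : ⇑(SchwartzMap.fderivCLM ℝ V F ψ) = _root_.fderiv ℝ ψ := rfl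
  rw [h1, norm_iteratedFDeriv_fderiv]
  exact SchwartzMap.le_seminorm ℝ 0 (m + 1) ψ x

/-- Taylor's estimate at a flat point: each induction step applies the mean value inequality on a
ball to the derivative, which is again flat. -/
theorem FlatAtZero.norm_le (m : ℕ) : ∀ {F : Type} [NormedAddCommGroup F] [NormedSpace ℝ F]
    {ψ : 𝓢(V, F)}, FlatAtZero ψ → ∀ y, ‖ψ y‖ ≤ SchwartzMap.seminorm ℝ 0 m ψ * ‖y‖ ^ m := by
  induction m with
  | zero =>
    intro F _ _ ψ _ y
    simpa using SchwartzMap.norm_le_seminorm ℝ ψ y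
  | succ m ih =>
    intro F _ _ ψ h y
    have h1 : ∀ w ∈ Metric.closedBall (0 : V) ‖y‖, ‖_root_.fderiv ℝ ψ w‖ ≤
        SchwartzMap.seminorm ℝ 0 (m + 1) ψ * ‖y‖ ^ m := by
      intro w hw
      refine (ih h.fderiv w).trans ?_
      have := seminorm_fderivCLM_le m ψ
      have hw' := mem_closedBall_zero_iff.1 hw
      gcongr
    have h2 := (convex_closedBall (0 : V) ‖y‖).norm_image_sub_le_of_norm_fderiv_le
      (fun w _ => ψ.differentiableAt) h1 (Metric.mem_closedBall_self (norm_nonneg y))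
      (mem_closedBall_zero_iff.2 le_rfl : y ∈ _)
    rw [h.apply_zero, sub_zero, sub_zero] at h2
    rw [pow_succ, ← mul_assoc]
    exact h2

theorem exists_bound_zpow_mul (k : ℤ) : ∃ q : 𝓢(V, F) → ℝ, Continuous q ∧ q 0 = 0 ∧
    ∀ ψ, FlatAtZero ψ → ∀ y, ‖y‖ ^ k * ‖ψ y‖ ≤ q ψ := by
  obtain ⟨m, rfl | rfl⟩ := k.eq_nat_or_neg
  · exact ⟨fun ψ => SchwartzMap.seminorm ℝ m 0 ψ, continuous_schwartz_seminorm m 0, by simp,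
      fun ψ _ y => by simpa using SchwartzMap.norm_pow_mul_le_seminorm ℝ ψ m y⟩
  · refine ⟨fun ψ => SchwartzMap.seminorm ℝ 0 m ψ, continuous_schwartz_seminorm 0 m, by simp,
      fun ψ hψ y => ?_⟩
    have h1 := hψ.norm_le m y
    rw [zpow_neg, zpow_natCast]
    calc (‖y‖ ^ m)⁻¹ * ‖ψ y‖ ≤ (‖y‖ ^ m)⁻¹ * (SchwartzMap.seminorm ℝ 0 m ψ * ‖y‖ ^ m) := by gcongr
      _ = SchwartzMap.seminorm ℝ 0 m ψ * ((‖y‖ ^ m)⁻¹ * ‖y‖ ^ m) := by ring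
      _ ≤ SchwartzMap.seminorm ℝ 0 m ψ * 1 := by gcongr; exact inv_mul_le_one
      _ = _ := mul_one _

/-- Adding the bounds for the exponents $j$ and $j+2$ produces the factor $1+s^2$. Flatness covers
negative exponents, rapid decrease the others. -/
theorem exists_bound_ray (j : ℤ) : ∃ q : 𝓢(V, F) → ℝ, Continuous q ∧ q 0 = 0 ∧ (∀ ψ, 0 ≤ q ψ) ∧
    ∀ ψ, FlatAtZero ψ → ∀ (s : ℝ) (x : V), 0 < s → x ≠ 0 →
      s ^ j * ‖ψ (s • x)‖ ≤ rayWeight j x * q ψ * (1 + s ^ 2)⁻¹ := by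
  obtain ⟨q₁, hq₁, hq₁0, h₁⟩ := exists_bound_zpow_mul (V := V) (F := F) j
  obtain ⟨q₂, hq₂, hq₂0, h₂⟩ := exists_bound_zpow_mul (V := V) (F := F) (j + 2)
  refine ⟨fun ψ => |q₁ ψ| + |q₂ ψ|, by fun_prop, by simp [hq₁0, hq₂0], fun ψ => by positivity,
    fun ψ hψ s x hs hx => ?_⟩
  have hx' : ‖x‖ ≠ 0 := norm_ne_zero_iff.2 hx
  have key : ∀ (k : ℤ) (C : ℝ), ‖s • x‖ ^ k * ‖ψ (s • x)‖ ≤ C →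
      s ^ k * ‖ψ (s • x)‖ ≤ ‖x‖ ^ (-k) * |C| := by
    intro k C hC
    rw [norm_smul, Real.norm_of_nonneg hs.le, mul_zpow] at hC
    have hpos : 0 < ‖x‖ ^ k := zpow_pos (norm_pos_iff.2 hx) _
    rw [zpow_neg, le_inv_mul_iff₀ hpos]
    calc _ = s ^ k * ‖x‖ ^ k * ‖ψ (s • x)‖ := by ring
      _ ≤ |C| := hC.trans (le_abs_self _)
  have e1 := key j _ (h₁ ψ hψ (s • x))
  have e2 := key (j + 2) _ (h₂ ψ hψ (s • x))
  rw [← div_eq_mul_inv, le_div_iff₀ (by positivity), rayWeight]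
  have e3 : s ^ (j + 2) = s ^ j * s ^ 2 := by
    rw [zpow_add₀ hs.ne']; norm_cast
  rw [e3] at e2
  have p1 : 0 ≤ ‖x‖ ^ (-j) := by positivity
  have p2 : 0 ≤ ‖x‖ ^ (-(j + 2)) := by positivity
  have p3 := abs_nonneg (q₁ ψ)
  have p4 := abs_nonneg (q₂ ψ)
  nlinarith [mul_nonneg p1 p4, mul_nonneg p2 p3]

end Flat

/-! ### The Fourier integral along half-lines -/

section HalfLine

variable {V F : Type} [NormedAddCommGroup V] [NormedSpace ℝ V] [NormedAddCommGroup F]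
  [NormedSpace ℝ F] [NormedSpace ℂ F]

/-- The integrand of `halfLine`. -/
def halfLineKernel (j : ℤ) (ψ : 𝓢(V, F)) (z : V × ℝ) (s : ℝ) : F :=
  s ^ j • (Real.fourierChar (s * z.2) : ℂ) • ψ (s • z.1)

/-- The integral `∫_{s > 0} s ^ j e^{2πisp} ψ (s x) ds`. -/
def halfLine (j : ℤ) (ψ : 𝓢(V, F)) (z : V × ℝ) : F :=
  ∫ s in Set.Ioi (0 : ℝ), halfLineKernel j ψ z s

theorem norm_halfLineKernel (j : ℤ) (ψ : 𝓢(V, F)) (z : V × ℝ) {s : ℝ} (hs : 0 < s) :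
    ‖halfLineKernel j ψ z s‖ = s ^ j * ‖ψ (s • z.1)‖ := by
  rw [halfLineKernel, norm_smul, norm_smul, Circle.norm_coe, one_mul,
    Real.norm_of_nonneg (zpow_nonneg hs.le j)]

theorem continuousOn_halfLineKernel (j : ℤ) (ψ : 𝓢(V, F)) (z : V × ℝ) :
    ContinuousOn (halfLineKernel j ψ z) (Set.Ioi 0) := by
  have h1 : ContinuousOn (fun s : ℝ => s ^ j) (Set.Ioi 0) := fun s hs =>
    (continuousAt_zpow₀ s j (Or.inl (ne_of_gt hs))).continuousWithinAt
  have h2 : Continuous fun s : ℝ => (Real.fourierChar (s * z.2) : ℂ) • ψ (s • z.1) := by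
    fun_prop
  exact h1.smul h2.continuousOn

theorem integrableOn_halfLineKernel (j : ℤ) {ψ : 𝓢(V, F)} (hψ : FlatAtZero ψ) {z : V × ℝ}
    (hz : z.1 ≠ 0) : IntegrableOn (halfLineKernel j ψ z) (Set.Ioi 0) := by
  obtain ⟨q, -, -, -, h⟩ := exists_bound_ray (V := V) (F := F) j
  refine ((integrable_inv_one_add_sq.const_mul (rayWeight j z.1 * q ψ)).restrict).mono'
    ((continuousOn_halfLineKernel j ψ z).aestronglyMeasurable measurableSet_Ioi) ?_
  refine (ae_restrict_iff' measurableSet_Ioi).2 (.of_forall fun s hs => ?_)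
  rw [norm_halfLineKernel j ψ z hs]
  exact h ψ hψ s z.1 hs hz

variable [IsScalarTower ℝ ℂ F]

/-- The operator that corresponds to the derivative under `halfLine`. -/
def halfLineDeriv (V F : Type) [NormedAddCommGroup V] [NormedSpace ℝ V] [NormedAddCommGroup F]
    [NormedSpace ℝ F] [NormedSpace ℂ F] [IsScalarTower ℝ ℂ F] :
    𝓢(V, F) →L[ℝ] 𝓢(V, V × ℝ →L[ℝ] F) :=
  (SchwartzMap.postcompCLM ((ContinuousLinearMap.compL ℝ (V × ℝ) V F).flip
    (ContinuousLinearMap.fst ℝ V ℝ))).comp (SchwartzMap.fderivCLM ℝ V F) +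
  SchwartzMap.postcompCLM ((ContinuousLinearMap.smulRightL ℝ (V × ℝ) F
    (ContinuousLinearMap.snd ℝ V ℝ)).comp
      ((2 * Real.pi * Complex.I : ℂ) • ContinuousLinearMap.id ℝ F))

theorem FlatAtZero.halfLineDeriv {ψ : 𝓢(V, F)} (h : FlatAtZero ψ) :
    FlatAtZero (halfLineDeriv V F ψ) :=
  (h.fderiv.postcomp _).add (h.postcomp _)

/-- Differentiating $\psi(sx)$ brings out $s$ and differentiating $e^{2\pi isp}$ brings out $2\pi
is$, so both terms fit one kernel of exponent $j+1$. -/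
theorem hasFDerivAt_halfLineKernel (j : ℤ) (ψ : 𝓢(V, F)) (z : V × ℝ) {s : ℝ} (hs : s ≠ 0) :
    HasFDerivAt (fun z => halfLineKernel j ψ z s)
      (halfLineKernel (j + 1) (halfLineDeriv V F ψ) z s) z := by
  have h1 : HasFDerivAt (fun z : V × ℝ => (Real.fourierChar (s * z.2) : ℂ))
      ((s • ContinuousLinearMap.snd ℝ V ℝ).smulRight
        (2 * Real.pi * Complex.I * (Real.fourierChar (s * z.2) : ℂ))) z := by
    have ha : HasFDerivAt (fun z : V × ℝ => s * z.2) (s • ContinuousLinearMap.snd ℝ V ℝ) z :=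
      (ContinuousLinearMap.snd ℝ V ℝ).hasFDerivAt.const_mul s
    have := (Real.hasDerivAt_fourierChar (s * z.2)).hasFDerivAt.comp z ha
    exact this.congr_fderiv (ContinuousLinearMap.ext fun v => by simp [mul_assoc])
  have h2 : HasFDerivAt (fun z : V × ℝ => ψ (s • z.1))
      (s • (fderiv ℝ ψ (s • z.1)).comp (ContinuousLinearMap.fst ℝ V ℝ)) z := by
    have hb : HasFDerivAt (fun z : V × ℝ => s • z.1) (s • ContinuousLinearMap.fst ℝ V ℝ) z :=
      (ContinuousLinearMap.fst ℝ V ℝ).hasFDerivAt.const_smul s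
    have := (ψ.hasFDerivAt (s • z.1)).comp z hb
    exact this.congr_fderiv (ContinuousLinearMap.ext fun v => by simp)
  have h3 := (h1.smul h2).const_smul (s ^ j)
  refine h3.congr_fderiv (ContinuousLinearMap.ext fun v => ?_)
  have key : ∀ (t : ℝ) (e c : ℂ) (a b : F), s ^ j • (e • s • a + ((s * t) • (c * e)) • b) =
      s ^ (j + 1) • e • (a + t • c • b) := by
    intro t e c a b
    simp only [zpow_add_one₀ hs, ← algebraMap_smul ℂ (_ : ℝ) (_ : F), Complex.coe_algebraMap,
      Complex.real_smul, Complex.ofReal_mul]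
    module
  exact key v.2 _ (2 * Real.pi * Complex.I) _ _

end HalfLine

/-! ### Smoothness and decay of `halfLine` -/

theorem isOpen_fst_ne_zero {V : Type} [NormedAddCommGroup V] : IsOpen {z : V × ℝ | z.1 ≠ 0} :=
  isOpen_ne_fun continuous_fst continuous_const

section HalfLineSmooth

variable {V F : Type} [NormedAddCommGroup V] [NormedSpace ℝ V] [NormedAddCommGroup F]
  [NormedSpace ℝ F] [NormedSpace ℂ F] [IsScalarTower ℝ ℂ F]

open Filter Topology in
theorem hasFDerivAt_halfLine (j : ℤ) {ψ : 𝓢(V, F)} (hψ : FlatAtZero ψ) {z : V × ℝ}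
    (hz : z.1 ≠ 0) :
    HasFDerivAt (halfLine j ψ) (halfLine (j + 1) (halfLineDeriv V F ψ) z) z := by
  obtain ⟨q, -, -, hq0, h⟩ := exists_bound_ray (V := V) (F := V × ℝ →L[ℝ] F) (j + 1)
  have hU : ∀ᶠ w : V × ℝ in 𝓝 z, w.1 ≠ 0 := continuous_fst.continuousAt.eventually_ne hz
  -- The weight blows up at $x=0$; on this neighbourhood it is bounded by a constant, which gives
  -- domination.
  have hU' : {w : V × ℝ | w.1 ≠ 0 ∧ rayWeight (j + 1) w.1 < rayWeight (j + 1) z.1 + 1} ∈ 𝓝 z := by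
    have h2 : ContinuousAt (fun w : V × ℝ => rayWeight (j + 1) w.1) z :=
      ContinuousAt.comp (g := rayWeight (j + 1)) (continuousAt_rayWeight (j + 1) hz)
        continuousAt_fst
    exact hU.and (h2.eventually_lt_const (lt_add_one _))
  refine hasFDerivAt_integral_of_dominated_of_fderiv_le (μ := volume.restrict (Set.Ioi 0))
    (F := fun w => halfLineKernel j ψ w)
    (F' := fun w => halfLineKernel (j + 1) (halfLineDeriv V F ψ) w)
    (bound := fun s => (rayWeight (j + 1) z.1 + 1) * q (halfLineDeriv V F ψ) * (1 + s ^ 2)⁻¹)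
    hU' ?_ ?_ ?_ ?_ ?_ ?_
  · exact hU.mono fun w hw => (integrableOn_halfLineKernel j hψ hw).1
  · exact integrableOn_halfLineKernel j hψ hz
  · exact (integrableOn_halfLineKernel (j + 1) hψ.halfLineDeriv hz).1
  · refine (ae_restrict_iff' measurableSet_Ioi).2 (.of_forall fun s hs w hw => ?_)
    rw [norm_halfLineKernel _ _ _ hs]
    refine (h _ hψ.halfLineDeriv s w.1 hs hw.1).trans ?_
    have := hq0 (halfLineDeriv V F ψ)
    have := hw.2.le
    gcongr
  · exact (integrable_inv_one_add_sq.const_mul _).restrict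
  · exact (ae_restrict_iff' measurableSet_Ioi).2 (.of_forall fun s hs w _ =>
      hasFDerivAt_halfLineKernel j ψ w (ne_of_gt hs))

theorem contDiffOn_halfLine_nat (m : ℕ) : ∀ {F : Type} [NormedAddCommGroup F] [NormedSpace ℝ F]
    [NormedSpace ℂ F] [IsScalarTower ℝ ℂ F] (j : ℤ) {ψ : 𝓢(V, F)}, FlatAtZero ψ →
    ContDiffOn ℝ m (halfLine j ψ) {z | z.1 ≠ 0} := by
  induction m with
  | zero =>
    intro F _ _ _ _ j ψ hψ
    exact contDiffOn_zero.2 fun z hz =>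
      (hasFDerivAt_halfLine j hψ hz).continuousAt.continuousWithinAt
  | succ m ih =>
    intro F _ _ _ _ j ψ hψ
    push_cast
    refine (contDiffOn_succ_iff_fderiv_of_isOpen isOpen_fst_ne_zero).2 ⟨fun z hz =>
      (hasFDerivAt_halfLine j hψ hz).differentiableAt.differentiableWithinAt, by simp, ?_⟩
    exact (ih (j + 1) hψ.halfLineDeriv).congr fun z hz => (hasFDerivAt_halfLine j hψ hz).fderiv

theorem contDiffOn_halfLine (j : ℤ) {ψ : 𝓢(V, F)} (hψ : FlatAtZero ψ) :
    ContDiffOn ℝ ∞ (halfLine j ψ) {z | z.1 ≠ 0} :=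
  contDiffOn_infty.2 fun m => contDiffOn_halfLine_nat m j hψ

open Filter Topology in
theorem norm_iteratedFDeriv_succ_halfLine (l : ℕ) (j : ℤ) {ψ : 𝓢(V, F)} (hψ : FlatAtZero ψ)
    {z : V × ℝ} (hz : z.1 ≠ 0) :
    ‖iteratedFDeriv ℝ (l + 1) (halfLine j ψ) z‖ =
      ‖iteratedFDeriv ℝ l (halfLine (j + 1) (halfLineDeriv V F ψ)) z‖ := by
  have h : fderiv ℝ (halfLine j ψ) =ᶠ[𝓝 z] halfLine (j + 1) (halfLineDeriv V F ψ) := by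
    filter_upwards [isOpen_fst_ne_zero.mem_nhds hz] with w hw
    exact (hasFDerivAt_halfLine j hψ hw).fderiv
  rw [← norm_iteratedFDeriv_fderiv, (h.iteratedFDeriv ℝ l).eq_of_nhds]

end HalfLineSmooth

/-! ### Integration by parts and decay of `halfLine` in the second variable -/

section Ray

variable {V F : Type} [NormedAddCommGroup V] [NormedSpace ℝ V] [NormedAddCommGroup F]
  [NormedSpace ℝ F]

/-- The profile `s ↦ s ^ j ψ (s x)` on the half-line `s > 0`, extended by zero. -/
def rayProfile (j : ℤ) (ψ : 𝓢(V, F)) (x : V) : ℝ → F :=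
  (Set.Ioi 0).indicator fun s => s ^ j • ψ (s • x)

theorem rayProfile_of_pos (j : ℤ) (ψ : 𝓢(V, F)) (x : V) {s : ℝ} (hs : 0 < s) :
    rayProfile j ψ x s = s ^ j • ψ (s • x) := Set.indicator_of_mem hs _

theorem rayProfile_of_nonpos (j : ℤ) (ψ : 𝓢(V, F)) (x : V) {s : ℝ} (hs : s ≤ 0) :
    rayProfile j ψ x s = 0 := Set.indicator_of_notMem (not_lt.2 hs) _

open Filter Topology in
theorem continuous_rayProfile (j : ℤ) {ψ : 𝓢(V, F)} (hψ : FlatAtZero ψ) {x : V} (hx : x ≠ 0) :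
    Continuous (rayProfile j ψ x) := by
  refine continuous_iff_continuousAt.2 fun s => ?_
  rcases lt_trichotomy s 0 with hs | rfl | hs
  · have : rayProfile j ψ x =ᶠ[𝓝 s] fun _ => 0 := by
      filter_upwards [Iio_mem_nhds hs] with t ht
      exact rayProfile_of_nonpos j ψ x (le_of_lt ht)
    exact continuousAt_const.congr this.symm
  -- Using the bound for exponent $j-1$ leaves a spare factor $|s|$, which forces the limit $0$ at
  -- the origin.
  · obtain ⟨q, -, -, hq0, h⟩ := exists_bound_ray (V := V) (F := F) (j - 1)
    rw [ContinuousAt, rayProfile_of_nonpos j ψ x le_rfl]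
    refine squeeze_zero_norm (a := fun s => |s| * (rayWeight (j - 1) x * q ψ)) (fun s => ?_) ?_
    · rcases le_or_gt s 0 with hs | hs
      · rw [rayProfile_of_nonpos j ψ x hs, norm_zero]
        have := hq0 ψ
        have := rayWeight_nonneg (j - 1) x
        positivity
      · have h1 := h ψ hψ s x hs hx
        have h2 : (1 + s ^ 2)⁻¹ ≤ 1 := inv_le_one_of_one_le₀ (by nlinarith [sq_nonneg s])
        have h3 : rayWeight (j - 1) x * q ψ * (1 + s ^ 2)⁻¹ ≤ rayWeight (j - 1) x * q ψ :=
          mul_le_of_le_one_right (mul_nonneg (rayWeight_nonneg _ _) (hq0 ψ)) h2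
        rw [rayProfile_of_pos j ψ x hs, norm_smul, Real.norm_of_nonneg (zpow_nonneg hs.le j),
          abs_of_pos hs]
        calc s ^ j * ‖ψ (s • x)‖ = s * (s ^ (j - 1) * ‖ψ (s • x)‖) := by
              rw [← mul_assoc, mul_comm s, ← zpow_add_one₀ hs.ne', sub_add_cancel]
          _ ≤ _ := mul_le_mul_of_nonneg_left (h1.trans h3) hs.le
    · have : Continuous fun s : ℝ => |s| * (rayWeight (j - 1) x * q ψ) := by fun_prop
      simpa using this.tendsto 0
  · have : rayProfile j ψ x =ᶠ[𝓝 s] fun s => s ^ j • ψ (s • x) := by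
      filter_upwards [Ioi_mem_nhds hs] with t ht
      exact rayProfile_of_pos j ψ x ht
    refine ContinuousAt.congr ?_ this.symm
    exact (continuousAt_zpow₀ s j (Or.inl hs.ne')).smul (by fun_prop)

variable [NormedSpace ℂ F]

theorem halfLineKernel_eq_rayProfile [IsScalarTower ℝ ℂ F] (j : ℤ) (ψ : 𝓢(V, F)) (z : V × ℝ)
    {s : ℝ} (hs : 0 < s) :
    halfLineKernel j ψ z s = (Real.fourierChar (s * z.2) : ℂ) • rayProfile j ψ z.1 s := by
  rw [rayProfile_of_pos j ψ z.1 hs, halfLineKernel, smul_comm]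

/-- The operator that corresponds to multiplication by `p` under `halfLine j`. -/
def byParts (V F : Type) [NormedAddCommGroup V] [NormedSpace ℝ V] [NormedAddCommGroup F]
    [NormedSpace ℝ F] [NormedSpace ℂ F] [IsScalarTower ℝ ℂ F] (j : ℤ) : 𝓢(V, F) →L[ℝ] 𝓢(V, F) :=
  (SchwartzMap.postcompCLM ((-(2 * Real.pi * Complex.I)⁻¹ : ℂ) • ContinuousLinearMap.id ℝ F)).comp
    (eulerCLM V F + SchwartzMap.postcompCLM ((j : ℝ) • ContinuousLinearMap.id ℝ F))

variable [IsScalarTower ℝ ℂ F]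

theorem byParts_apply (j : ℤ) (ψ : 𝓢(V, F)) (y : V) : byParts V F j ψ y =
    (-(2 * Real.pi * Complex.I)⁻¹ : ℂ) • (fderiv ℝ ψ y y + (j : ℝ) • ψ y) := rfl

theorem FlatAtZero.byParts {ψ : 𝓢(V, F)} (h : FlatAtZero ψ) (j : ℤ) :
    FlatAtZero (byParts V F j ψ) :=
  (h.euler.add (h.postcomp _)).postcomp _

theorem hasDerivAt_halfLineKernel (j : ℤ) (ψ : 𝓢(V, F)) (z : V × ℝ) {s : ℝ} (hs : s ≠ 0) :
    HasDerivAt (halfLineKernel j ψ z) ((2 * Real.pi * Complex.I : ℂ) •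
      (z.2 • halfLineKernel j ψ z s - halfLineKernel (j - 1) (byParts V F j ψ) z s)) s := by
  have h1 : HasDerivAt (fun s : ℝ => (Real.fourierChar (s * z.2) : ℂ))
      (z.2 • (2 * Real.pi * Complex.I * (Real.fourierChar (s * z.2) : ℂ))) s := by
    have := (Real.hasDerivAt_fourierChar (s * z.2)).scomp s (hasDerivAt_mul_const z.2)
    exact this
  have h2 : HasDerivAt (fun s : ℝ => ψ (s • z.1)) (fderiv ℝ ψ (s • z.1) z.1) s := by
    have hb : HasDerivAt (fun s : ℝ => s • z.1) z.1 s := by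
      simpa using (hasDerivAt_id s).smul_const z.1
    exact (ψ.hasFDerivAt (s • z.1)).comp_hasDerivAt s hb
  have h3 := (hasDerivAt_zpow j s (Or.inl hs)).smul (h1.smul h2)
  refine h3.congr_deriv ?_
  have hpi : (2 * Real.pi * Complex.I : ℂ) ≠ 0 := Complex.two_pi_I_ne_zero
  simp only [halfLineKernel, byParts_apply, map_smul, Pi.smul_apply']
  have hsj : s ^ j = s ^ (j - 1) * s := by rw [← zpow_add_one₀ hs, sub_add_cancel]
  rw [hsj]
  generalize (Real.fourierChar (s * z.2) : ℂ) = e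
  generalize fderiv ℝ ψ (s • z.1) z.1 = a
  generalize ψ (s • z.1) = b
  generalize (2 * Real.pi * Complex.I : ℂ) = c at hpi ⊢
  simp only [← algebraMap_smul ℂ (_ : ℝ) (_ : F), Complex.coe_algebraMap,
      Complex.real_smul, Complex.ofReal_mul, Complex.ofReal_intCast]
  match_scalars <;> field_simp
  ring

-- Integration by parts in $s$: the exponential yields $2\pi ip$, the profile $s^j\psi(sx)$ yields
-- $s^{j-1}(D\psi(y)y+j\psi(y))$ at $y=sx$. The boundary term vanishes at $0$ by flatness and at
-- infinity by integrability.
open Filter Topology in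
theorem smul_halfLine [CompleteSpace F] (j : ℤ) {ψ : 𝓢(V, F)} (hψ : FlatAtZero ψ) {z : V × ℝ}
    (hz : z.1 ≠ 0) : z.2 • halfLine j ψ z = halfLine (j - 1) (byParts V F j ψ) z := by
  have hi1 := integrableOn_halfLineKernel j hψ hz
  have hi2 := integrableOn_halfLineKernel (j - 1) (hψ.byParts j) hz
  have hi : IntegrableOn (fun s => (2 * Real.pi * Complex.I : ℂ) •
      (z.2 • halfLineKernel j ψ z s - halfLineKernel (j - 1) (byParts V F j ψ) z s))
      (Set.Ioi 0) := ((hi1.smul z.2).sub hi2).smul _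
  have hd : ∀ s ∈ Set.Ioi (0 : ℝ), HasDerivAt (halfLineKernel j ψ z) _ s := fun s hs =>
    hasDerivAt_halfLineKernel j ψ z (ne_of_gt hs)
  have h0 : halfLineKernel j ψ z 0 = 0 := by simp [halfLineKernel, hψ.apply_zero]
  have hc : ContinuousWithinAt (halfLineKernel j ψ z) (Set.Ici 0) 0 := by
    have h1 : Continuous fun s : ℝ =>
        (Real.fourierChar (s * z.2) : ℂ) • rayProfile j ψ z.1 s :=
      Continuous.smul (by fun_prop) (continuous_rayProfile j hψ hz)
    refine h1.continuousWithinAt.congr (fun s hs => ?_) ?_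
    · rcases (Set.mem_Ici.1 hs).eq_or_lt with rfl | hs
      · rw [h0, rayProfile_of_nonpos j ψ z.1 le_rfl, smul_zero]
      · exact halfLineKernel_eq_rayProfile j ψ z hs
    · rw [h0, rayProfile_of_nonpos j ψ z.1 le_rfl, smul_zero]
  have h := integral_Ioi_of_hasDerivAt_of_tendsto hc hd hi
    (tendsto_zero_of_hasDerivAt_of_integrableOn_Ioi hd hi hi1)
  rw [h0, sub_zero, integral_smul, smul_eq_zero_iff_right Complex.two_pi_I_ne_zero] at h
  exact (integral_smul z.2 _).symm.trans
    (sub_eq_zero.1 ((integral_sub (hi1.smul z.2) hi2).symm.trans h))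

/-- Each power of $p$ lowers the exponent by one, possibly below zero; hence integer exponents and a
statement for all `j`. -/
theorem exists_bound_pow_mul_halfLine [CompleteSpace F] (k : ℕ) : ∀ j : ℤ,
    ∃ q : 𝓢(V, F) → ℝ, Continuous q ∧ q 0 = 0 ∧ ∀ ψ, FlatAtZero ψ → ∀ z : V × ℝ, ‖z.1‖ = 1 →
      |z.2| ^ k * ‖halfLine j ψ z‖ ≤ q ψ := by
  induction k with
  | zero =>
    intro j
    obtain ⟨q, hq, hq0, -, h⟩ := exists_bound_ray (V := V) (F := F) j
    refine ⟨fun ψ => 2 * q ψ * ∫ s : ℝ in Set.Ioi 0, (1 + s ^ 2)⁻¹, by fun_prop, by simp [hq0],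
      fun ψ hψ z hz => ?_⟩
    have hz0 : z.1 ≠ 0 := norm_ne_zero_iff.1 (by rw [hz]; exact one_ne_zero)
    have hw : rayWeight j z.1 = 2 := by rw [rayWeight, hz, one_zpow, one_zpow]; norm_num
    beta_reduce
    rw [pow_zero, one_mul, ← integral_const_mul]
    refine norm_integral_le_of_norm_le ((integrable_inv_one_add_sq.const_mul _).restrict) ?_
    refine (ae_restrict_iff' measurableSet_Ioi).2 (.of_forall fun s hs => ?_)
    rw [norm_halfLineKernel _ _ _ hs, ← hw]
    exact h ψ hψ s z.1 hs hz0
  | succ k ih =>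
    intro j
    obtain ⟨q, hq, hq0, h⟩ := ih (j - 1)
    refine ⟨fun ψ => q (byParts V F j ψ), hq.comp (byParts V F j).continuous, by simp [hq0],
      fun ψ hψ z hz => ?_⟩
    have hz0 : z.1 ≠ 0 := norm_ne_zero_iff.1 (by rw [hz]; exact one_ne_zero)
    have h1 := h _ (hψ.byParts j) z hz
    rwa [← smul_halfLine j hψ hz0, norm_smul, Real.norm_eq_abs, ← mul_assoc, ← pow_succ] at h1

theorem exists_bound_iteratedFDeriv_halfLine (l k : ℕ) : ∀ {F : Type} [NormedAddCommGroup F]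
    [NormedSpace ℝ F] [NormedSpace ℂ F] [IsScalarTower ℝ ℂ F] [CompleteSpace F] (j : ℤ),
    ∃ q : 𝓢(V, F) → ℝ, Continuous q ∧ q 0 = 0 ∧ ∀ ψ, FlatAtZero ψ → ∀ z : V × ℝ, ‖z.1‖ = 1 →
      |z.2| ^ k * ‖iteratedFDeriv ℝ l (halfLine j ψ) z‖ ≤ q ψ := by
  induction l with
  | zero =>
    intro F _ _ _ _ _ j
    simpa only [norm_iteratedFDeriv_zero] using exists_bound_pow_mul_halfLine k j
  | succ l ih =>
    intro F _ _ _ _ _ j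
    obtain ⟨q, hq, hq0, h⟩ := ih (F := V × ℝ →L[ℝ] F) (j + 1)
    refine ⟨fun ψ => q (halfLineDeriv V F ψ), hq.comp (halfLineDeriv V F).continuous,
      by simp [hq0], fun ψ hψ z hz => ?_⟩
    rw [norm_iteratedFDeriv_succ_halfLine l j hψ
      (norm_ne_zero_iff.1 (by rw [hz]; exact one_ne_zero))]
    exact h _ hψ.halfLineDeriv z hz

end Ray

/-! ### Vanishing moments of `halfLine` -/

section Moments

variable {V : Type} [NormedAddCommGroup V] [NormedSpace ℝ V]

theorem halfLine_eq_fourierInv (j : ℤ) (ψ : 𝓢(V, ℂ)) (x : V) (p : ℝ) :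
    halfLine j ψ (x, p) = FourierTransform.fourierInv (rayProfile j ψ x) p := by
  rw [Real.fourierInv_eq, halfLine, ← integral_indicator measurableSet_Ioi]
  refine integral_congr_ae (.of_forall fun s => ?_)
  rcases le_or_gt s 0 with hs | hs
  · simp only [rayProfile_of_nonpos j ψ x hs, smul_zero]
    exact Set.indicator_of_notMem (not_lt.2 hs) _
  · simp only [Set.indicator_of_mem (Set.mem_Ioi.2 hs), halfLineKernel_eq_rayProfile j ψ _ hs]
    rw [real_inner_comm]
    rfl

theorem integrable_halfLine (j : ℤ) {ψ : 𝓢(V, ℂ)} (hψ : FlatAtZero ψ) {x : V} (hx : ‖x‖ = 1) :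
    Integrable fun p : ℝ => halfLine j ψ (x, p) := by
  obtain ⟨q, -, -, h⟩ := exists_bound_pow_mul_halfLine (V := V) (F := ℂ) 0 j
  obtain ⟨r, -, -, h'⟩ := exists_bound_pow_mul_halfLine (V := V) (F := ℂ) 2 j
  have hx0 : x ≠ 0 := norm_ne_zero_iff.1 (by rw [hx]; exact one_ne_zero)
  have hc : Continuous fun p : ℝ => halfLine j ψ (x, p) := continuous_iff_continuousAt.2 fun p =>
    ContinuousAt.comp (f := fun p : ℝ => (x, p)) (hasFDerivAt_halfLine j hψ hx0).continuousAt
      (by fun_prop)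
  refine (integrable_inv_one_add_sq.const_mul (q ψ + r ψ)).mono' hc.aestronglyMeasurable
    (.of_forall fun p => ?_)
  have h1 := h ψ hψ (x, p) hx
  have h2 := h' ψ hψ (x, p) hx
  simp only [pow_zero, one_mul, sq_abs] at h1 h2
  rw [← div_eq_mul_inv, le_div_iff₀ (by positivity)]
  linarith

/-- In $p$ the function is the inverse Fourier transform of the ray profile, so its integral is the
profile's value at $s=0$, which is zero. Pointwise inversion needs the continuity of the profile
across $0$. -/
theorem integral_halfLine (j : ℤ) {ψ : 𝓢(V, ℂ)} (hψ : FlatAtZero ψ) {x : V} (hx : ‖x‖ = 1) :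
    ∫ p : ℝ, halfLine j ψ (x, p) = 0 := by
  have hx0 : x ≠ 0 := norm_ne_zero_iff.1 (by rw [hx]; exact one_ne_zero)
  have hc := continuous_rayProfile j hψ hx0
  have hi : Integrable (rayProfile j ψ x) := by
    refine (integrable_indicator_iff measurableSet_Ioi).2 ?_
    refine (integrableOn_halfLineKernel j hψ (z := (x, 0)) hx0).congr_fun (fun s _ => ?_)
      measurableSet_Ioi
    simp [halfLineKernel]
  have hF : FourierTransform.fourierInv (rayProfile j ψ x) = fun p => halfLine j ψ (x, p) :=
    funext fun p => (halfLine_eq_fourierInv j ψ x p).symm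
  have hi' : Integrable (FourierTransform.fourier (rayProfile j ψ x)) := by
    have := (integrable_halfLine j hψ hx).comp_neg
    refine this.congr (.of_forall fun p => ?_)
    simp only [halfLine_eq_fourierInv, Real.fourierInv_eq_fourier_neg, neg_neg]
  have h := congrFun (hc.fourier_fourierInv_eq hi hi') 0
  rw [rayProfile_of_nonpos j ψ x le_rfl, hF, Real.fourier_eq] at h
  simpa using h

theorem integral_pow_mul_halfLine (k : ℕ) : ∀ (j : ℤ) {ψ : 𝓢(V, ℂ)}, FlatAtZero ψ → ∀ {x : V},
    ‖x‖ = 1 → ∫ p : ℝ, (p : ℂ) ^ k * halfLine j ψ (x, p) = 0 := by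
  induction k with
  | zero => intro j ψ hψ x hx; simpa using integral_halfLine j hψ hx
  | succ k ih =>
    intro j ψ hψ x hx
    rw [← ih (j - 1) (hψ.byParts j) hx]
    congr 1 with p
    rw [← smul_halfLine j hψ (z := (x, p)) (norm_ne_zero_iff.1 (by rw [hx]; exact one_ne_zero)),
      Complex.real_smul, pow_succ, mul_assoc]

end Moments

/-! ### The Fourier transform of a Lizorkin function is flat at the origin -/

section FourierFlat

variable {n : ℕ}

/-- The $m$-th derivative of the Fourier transform at $0$, evaluated on basis vectors indexed by
`σ`, is a constant times the moment whose exponents count how often each coordinate occurs in `σ`.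
-/
theorem flatAtZero_fourier (φ : lizorkin n) :
    FlatAtZero (FourierTransform.fourier (φ : 𝓢(E n, ℂ))) := by
  intro m
  set ψ : 𝓢(E n, ℂ) := φ.1
  have hint : ∀ k : ℕ, (k : ℕ∞) ≤ m → Integrable fun v => ‖v‖ ^ k * ‖ψ v‖ := fun k _ =>
    ψ.integrable_pow_mul volume k
  have hmeas := ψ.continuous.aestronglyMeasurable (μ := volume)
  rw [SchwartzMap.fourier_coe, Real.iteratedFDeriv_fourier hint hmeas le_rfl, Real.fourier_eq]
  simp only [inner_zero_right, neg_zero, AddChar.map_zero_eq_one, one_smul]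
  have hi := VectorFourier.integrable_fourierPowSMulRight (innerSL ℝ) (hint m le_rfl) hmeas
  refine ContinuousMultilinearMap.toMultilinearMap_injective
    (Module.Basis.ext_multilinear (fun _ => (EuclideanSpace.basisFun (Fin n) ℝ).toBasis)
      fun σ => ?_)
  have h0 := φ.2 fun k => (Finset.univ.filter fun i => σ i = k).card
  refine (ContinuousMultilinearMap.integral_apply hi _).trans ?_
  have h1 : ∀ v : E n, VectorFourier.fourierPowSMulRight (innerSL ℝ) ψ v m
      (fun i => (EuclideanSpace.basisFun (Fin n) ℝ).toBasis (σ i)) =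
      (-(2 * Real.pi * Complex.I)) ^ m *
        (((∏ k, v k ^ (Finset.univ.filter fun i => σ i = k).card : ℝ) : ℂ) * ψ v) := by
    intro v
    have h2 : ∏ i, innerSL ℝ v ((EuclideanSpace.basisFun (Fin n) ℝ).toBasis (σ i)) =
        ∏ k, v k ^ (Finset.univ.filter fun i => σ i = k).card := by
      simp only [← Finset.prod_const, Finset.prod_fiberwise' Finset.univ σ fun k => v k]
      exact Finset.prod_congr rfl fun i _ => by simp [EuclideanSpace.inner_single_right]
    rw [VectorFourier.fourierPowSMulRight_apply, smul_eq_mul, ← Complex.real_smul, h2]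
  simp only [h1]
  rw [integral_const_mul, h0, mul_zero]
  rfl

end FourierFlat

/-! ### Half-line integrals over the cylinder -/

section Cylinder

variable {n : ℕ}

/-- The restriction of `halfLine j ψ` to the cylinder. -/
def cylinderFun (j : ℤ) (ψ : 𝓢(E n, ℂ)) (u : S n) (p : ℝ) : ℂ := halfLine j ψ ((u : E n), p)

theorem homExt_cylinderFun (j : ℤ) (ψ : 𝓢(E n, ℂ)) {z : E n × ℝ} (hz : z.1 ≠ 0) :
    homExt (cylinderFun j ψ) z = halfLine j ψ (‖z.1‖⁻¹ • z.1, z.2) := dif_pos hz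

theorem homExt_cylinderFun_of_mem (j : ℤ) (ψ : 𝓢(E n, ℂ)) {z : E n × ℝ} (hz : z ∈ collar n) :
    homExt (cylinderFun j ψ) z = (1 : ℝ) • halfLine j ψ (normalizeFst z) := by
  rw [homExt_cylinderFun j ψ (fst_ne_zero_of_mem_collar hz), normalizeFst_of_mem hz, one_smul]
  rfl

theorem isSmooth_cylinderFun (j : ℤ) {ψ : 𝓢(E n, ℂ)} (hψ : FlatAtZero ψ) :
    IsSmooth (cylinderFun j ψ) := by
  have h : ContDiffOn ℝ ∞ (fun z : E n × ℝ => (‖z.1‖⁻¹ • z.1, z.2)) {z | z.1 ≠ 0} := by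
    intro z hz
    exact ((((contDiffAt_norm ℝ hz).comp z contDiffAt_fst).inv (norm_ne_zero_iff.2 hz)).smul
      contDiffAt_fst |>.prodMk contDiffAt_snd).contDiffWithinAt
  refine ((contDiffOn_halfLine j hψ).comp h fun z hz => ?_).congr fun z hz =>
    homExt_cylinderFun j ψ hz
  exact smul_ne_zero (inv_ne_zero (norm_ne_zero_iff.2 hz)) hz

theorem exists_bound_one_add_pow_halfLine (j : ℤ) (m l : ℕ) :
    ∃ q : 𝓢(E n, ℂ) → ℝ, Continuous q ∧ q 0 = 0 ∧ ∀ ψ, FlatAtZero ψ → ∀ (u : S n) (p : ℝ),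
      ∀ i ≤ l, (1 + |p|) ^ m * ‖iteratedFDeriv ℝ i (halfLine j ψ) ((u : E n), p)‖ ≤ q ψ := by
  choose q₁ hq₁ hq₁0 h₁ using fun i =>
    exists_bound_iteratedFDeriv_halfLine (V := E n) i 0 (F := ℂ) j
  choose q₂ hq₂ hq₂0 h₂ using fun i =>
    exists_bound_iteratedFDeriv_halfLine (V := E n) i m (F := ℂ) j
  refine ⟨fun ψ => ∑ i ∈ Finset.range (l + 1), 2 ^ (m - 1) * (|q₁ i ψ| + |q₂ i ψ|), ?_,
    by simp [hq₁0, hq₂0], fun ψ hψ u p i hi => ?_⟩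
  · exact continuous_finsetSum _ fun i _ => continuous_const.mul ((hq₁ i).abs.add (hq₂ i).abs)
  · refine le_trans ?_ (Finset.single_le_sum (f := fun i =>
      2 ^ (m - 1) * (|q₁ i ψ| + |q₂ i ψ|)) (fun j _ => by positivity)
      (Finset.mem_range.2 (Nat.lt_succ_of_le hi)))
    have hu : ‖(u : E n)‖ = 1 := by simp
    have h1 := (h₁ i ψ hψ ((u : E n), p) hu).trans (le_abs_self _)
    have h2 := (h₂ i ψ hψ ((u : E n), p) hu).trans (le_abs_self _)
    have h3 := add_pow_le zero_le_one (abs_nonneg p) m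
    rw [pow_zero, one_mul] at h1
    calc _ ≤ 2 ^ (m - 1) * (1 ^ m + |p| ^ m) *
          ‖iteratedFDeriv ℝ i (halfLine j ψ) ((u : E n), p)‖ := by gcongr
      _ = 2 ^ (m - 1) * (‖iteratedFDeriv ℝ i (halfLine j ψ) ((u : E n), p)‖ +
          |p| ^ m * ‖iteratedFDeriv ℝ i (halfLine j ψ) ((u : E n), p)‖) := by ring
      _ ≤ _ := mul_le_mul_of_nonneg_left (add_le_add h1 h2) (by positivity)

/-- Near the cylinder the homogeneous extension is `halfLine j ψ` composed with `normalizeFst`,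
which fixes the cylinder pointwise; the chain rule transfers the decay. -/
theorem exists_bound_cylinderFun (j : ℤ) (k l : ℕ) :
    ∃ q : 𝓢(E n, ℂ) → ℝ, Continuous q ∧ q 0 = 0 ∧ ∀ ψ, FlatAtZero ψ → ∀ (u : S n) (p : ℝ),
      |p| ^ k * ‖iteratedFDeriv ℝ l (homExt (cylinderFun j ψ)) ((u : E n), p)‖ ≤ q ψ := by
  obtain ⟨m, C, hC, h⟩ := exists_bound_iteratedFDeriv_smul_comp (n := n)
    hasTemperateGrowth_normalizeFst (Function.HasTemperateGrowth.const (1 : ℝ))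
    mapsTo_normalizeFst l
  obtain ⟨q, hq, hq0, hb⟩ := exists_bound_one_add_pow_halfLine (n := n) j (k + m) l
  refine ⟨fun ψ => C * 2 ^ m * |q ψ|, by fun_prop, by simp [hq0], fun ψ hψ u p => ?_⟩
  have hmem := sphere_mem_collar u p
  have hev : homExt (cylinderFun j ψ) =ᶠ[nhds ((u : E n), p)]
      fun z => (1 : ℝ) • halfLine j ψ (normalizeFst z) := by
    filter_upwards [isOpen_collar.mem_nhds hmem] with z hz
    exact homExt_cylinderFun_of_mem j ψ hz
  have hnorm : normalizeFst ((u : E n), p) = ((u : E n), p) := by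
    rw [normalizeFst_of_mem hmem, toSphere]
    simp
  have hM : ∀ i ≤ l, ‖iteratedFDeriv ℝ i (halfLine j ψ) (normalizeFst ((u : E n), p))‖ ≤
      ((1 + |p|) ^ (k + m))⁻¹ * |q ψ| := by
    intro i hi
    rw [hnorm, le_inv_mul_iff₀ (by positivity)]
    exact (hb ψ hψ u p i hi).trans (le_abs_self _)
  have hpz : 1 + ‖((u : E n), p)‖ ≤ 2 * (1 + |p|) := by
    have hu : ‖(u : E n)‖ = 1 := by simp
    have := abs_nonneg p
    rw [Prod.norm_mk, hu, Real.norm_eq_abs]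
    rcases max_choice 1 |p| with e | e <;> rw [e] <;> linarith
  rw [(hev.iteratedFDeriv ℝ l).eq_of_nhds]
  calc |p| ^ k * ‖iteratedFDeriv ℝ l (fun z => (1 : ℝ) • halfLine j ψ (normalizeFst z))
          ((u : E n), p)‖
      ≤ (1 + |p|) ^ k * (C * (2 * (1 + |p|)) ^ m * (((1 + |p|) ^ (k + m))⁻¹ * |q ψ|)) := by
        gcongr
        · linarith
        · refine (h _ (contDiffOn_halfLine j hψ) _ hmem _ hM).trans ?_
          gcongr
    _ = C * 2 ^ m * |q ψ| := by
        rw [mul_pow]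
        field_simp
        ring

/-- The half-line integral of a flat function, as a rapidly decreasing function on the cylinder. -/
def cylinderSchwartz (j : ℤ) {ψ : 𝓢(E n, ℂ)} (hψ : FlatAtZero ψ) : SphereSchwartz n :=
  ⟨cylinderFun j ψ, isSmooth_cylinderFun j hψ, fun k l => by
    obtain ⟨q, -, -, h⟩ := exists_bound_cylinderFun (n := n) j k l
    exact ⟨q ψ, h ψ hψ⟩⟩

theorem cylinderSchwartz_mem (j : ℤ) {ψ : 𝓢(E n, ℂ)} (hψ : FlatAtZero ψ) :
    cylinderSchwartz j hψ ∈ sphereLizorkin n := fun u k =>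
  integral_pow_mul_halfLine k j hψ (by simp)

theorem halfLine_add {j : ℤ} {ψ χ : 𝓢(E n, ℂ)} (hψ : FlatAtZero ψ) (hχ : FlatAtZero χ)
    {z : E n × ℝ} (hz : z.1 ≠ 0) : halfLine j (ψ + χ) z = halfLine j ψ z + halfLine j χ z := by
  rw [halfLine, halfLine, halfLine, ← integral_add (integrableOn_halfLineKernel j hψ hz)
    (integrableOn_halfLineKernel j hχ hz)]
  simp [halfLineKernel, mul_add]

theorem halfLine_smul (j : ℤ) (c : ℂ) (ψ : 𝓢(E n, ℂ)) (z : E n × ℝ) :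
    halfLine j (c • ψ) z = c * halfLine j ψ z := by
  rw [halfLine, halfLine, ← integral_const_mul]
  congr 1 with s
  simp [halfLineKernel]
  ring

open FourierTransform in
/-- A continuous right inverse of the dual Radon transform. -/
def rightInverseCLM (n : ℕ) : lizorkin n →L[ℂ] sphereLizorkin n :=
  let T : lizorkin n →ₗ[ℂ] SphereSchwartz n :=
    -- The exponent, an integer difference, is that of the polar density $r^{n-1}\,dr$.
    { toFun := fun φ => cylinderSchwartz (n - 1) (flatAtZero_fourier φ)
      map_add' := fun φ φ' => Subtype.ext <| funext fun u => funext fun p => by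
        change halfLine _ (𝓕 (φ.1 + φ'.1)) _ = _
        rw [FourierTransform.fourier_add]
        exact halfLine_add (flatAtZero_fourier φ) (flatAtZero_fourier φ') (sphere_ne_zero u)
      map_smul' := fun c φ => Subtype.ext <| funext fun u => funext fun p => by
        change halfLine _ (𝓕 (c • φ.1)) _ = _
        rw [FourierTransform.fourier_smul]
        exact halfLine_smul _ c _ _ }
  have hT : Continuous T := by
    refine continuous_of_seminorm_bounds (SphereSchwartz.withSeminorms n) T fun i => ?_
    obtain ⟨q, hq, hq0, h⟩ := exists_bound_cylinderFun (n := n) (n - 1) i.1 i.2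
    have hF : Continuous fun φ : lizorkin n => 𝓕 (φ : 𝓢(E n, ℂ)) :=
      (SchwartzMap.fourierTransformCLM ℂ).continuous.comp continuous_subtype_val
    refine ⟨fun φ => |q (𝓕 (φ : 𝓢(E n, ℂ)))|, (hq.comp hF).abs, ?_, fun φ =>
      Real.iSup_le (fun z => ?_) (abs_nonneg _)⟩
    · simp [FourierTransform.fourier_zero, hq0]
    · exact (h _ (flatAtZero_fourier φ) z.1 z.2).trans (le_abs_self _)
  { toLinearMap := T.codRestrict (sphereLizorkin n) fun φ =>
      cylinderSchwartz_mem (n - 1) (flatAtZero_fourier φ)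
    cont := hT.subtype_mk _ }

open FourierTransform in
theorem rightInverseCLM_fn (φ : lizorkin n) (u : S n) (p : ℝ) :
    (rightInverseCLM n φ).1.fn u p = halfLine (n - 1) (𝓕 (φ : 𝓢(E n, ℂ))) ((u : E n), p) := rfl

-- The Fourier inversion formula for $\varphi$, written in polar coordinates $\xi=ru$ with phase
-- $r(x\cdot u)$: the inner radial integral is exactly the half-line integral.
open FourierTransform in
theorem backProjectionCLM_rightInverseCLM [NeZero n] (φ : lizorkin n) :
    backProjectionCLM n (rightInverseCLM n φ) = φ := by
  refine Subtype.ext (SchwartzMap.ext fun x => ?_)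
  set ψ : 𝓢(E n, ℂ) := 𝓕 (φ : 𝓢(E n, ℂ)) with hψ
  have hi : Integrable fun ξ : E n => Real.fourierChar (inner ℝ ξ x) • ψ ξ := by
    refine ψ.integrable.norm.mono' (by fun_prop) (.of_forall fun ξ => ?_)
    rw [Circle.norm_smul]
  have h1 : (φ : 𝓢(E n, ℂ)) x = ∫ ξ : E n, Real.fourierChar (inner ℝ ξ x) • ψ ξ := by
    rw [← Real.fourierInv_eq, ← SchwartzMap.fourierInv_coe, hψ,
      FourierTransform.fourierInv_fourier_eq]
  rw [backProjectionCLM_apply, h1, integral_eq_integral_sphere hi, backProjection]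
  congr 1 with u
  rw [rightInverseCLM_fn, halfLine]
  refine setIntegral_congr_fun measurableSet_Ioi fun r _ => ?_
  have hn : ((n : ℤ) - 1) = ((n - 1 : ℕ) : ℤ) := by
    have := NeZero.pos n
    omega
  rw [halfLineKernel, hn, zpow_natCast, inner_smul_left, real_inner_comm, Circle.smul_def]
  rfl

end Cylinder

end LizorkinRadon

end

/-! ### The Radon transform as a transpose. -/

theorem proposition3p1 (n : ℕ) (hn : 2 ≤ n) :
    ∃ R : LizorkinRadon.LizorkinDistribution n →ₗ[ℂ] LizorkinRadon.SphereLizorkinDistribution n,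
      (∀ f, LizorkinRadon.IsRadonTransform f (R f)) ∧
      ∃ e : LizorkinRadon.LizorkinDistribution n ≃L[ℂ] LinearMap.range R,
        ∀ f, (e f : LizorkinRadon.SphereLizorkinDistribution n) = R f := by
  have : NeZero n := ⟨by omega⟩
  -- Transposes are continuous for the strong topologies because continuous linear maps send bounded
  -- sets to bounded sets.
  let R : LizorkinRadon.LizorkinDistribution n →L[ℂ] LizorkinRadon.SphereLizorkinDistribution n :=
    ContinuousLinearMap.precomp ℂ (LizorkinRadon.backProjectionCLM n)
  let Q : LizorkinRadon.SphereLizorkinDistribution n →L[ℂ] LizorkinRadon.LizorkinDistribution n :=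
    ContinuousLinearMap.precomp ℂ (LizorkinRadon.rightInverseCLM n)
  have hQR : ∀ f, Q (R f) = f := fun f => ContinuousLinearMap.ext fun φ =>
    congrArg f (LizorkinRadon.backProjectionCLM_rightInverseCLM φ)
  refine ⟨R.toLinearMap, fun f ρ => ⟨LizorkinRadon.backProjectionCLM n ρ,
    LizorkinRadon.backProjectionCLM_apply ρ, rfl⟩, ?_⟩
  refine ⟨{ toLinearEquiv := LinearEquiv.ofLeftInverse (f := R.toLinearMap) (g := Q) hQR
            continuous_toFun := R.continuous.subtype_mk _
            continuous_invFun := Q.continuous.comp continuous_subtype_val }, fun f => rfl⟩
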